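/- Consider an explicit Runge--Kutta scheme with $s$ stages, weights $b_i\in\mathbb C$ and coefficients $a_{ij}\in\mathbb C$ ($j<i$). For a linear system $u'=\mathbf L u$, $\mathbf L\in\mathbb C^{n\times n}$, one step with time step $\tau>0$ is $$u^1=u^0+\tau\sum_{i=1}^s b_iK_i,\qquad K_i=\mathbf L\Big(u^0+\tau\sum_{j=1}^{i-1}a_{ij}K_j\Big),\quad i=1,\dots,s.$$ Its stability function is the polynomial $R(z)=\sum_{j=0}^{s} c_j z^j/j!$ with $u^1=R(\tau\mathbf L)u^0$; put $c_j=0$ for $j>s$. The scheme has order $p$ (for linear systems) if $u(\tau)-u^1=O(\tau^{p+1})$ as $\tau\to0^+$ for every $\mathbf L$ and every exact solution $u$ of $u'=\mathbf L u$ with $u(0)=u^0$. Let $\mathbf L_H=(\mathbf L+\mathbf L^*)/2$ and $\mathbf L_S=(\mathbf L-\mathbf L^*)/2$. Let $\mathcal L_{AS}$ be the set of all complex square matrices $\mathbf L$, of any dimension, that are asymptotically stable (all eigenvalues have negative real part) and semi-dissipative ($\mathbf L_H\le 0$). The hypocoercivity index $m_{HC}(\mathbf L)$ is the smallest $m\in\mathbb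 N_0$ such that $\sum_{j=0}^m\mathbf L_S^j\mathbf L_H(\mathbf L_S^*)^j<0$ (and $\infty$ if there is none). Put $\mathcal L_{AS}^m=\{\mathbf L\in\mathcal L_{AS}: m_{HC}(\mathbf L)\le m\}$. The scheme is called strongly stable with respect to a set $\mathcal L_0\subset\mathcal L_{AS}$ if for every $\mathbf L\in\mathcal L_0$ there is $\tau_0>0$ such that $\|u^1\|\le\|u^0\|$ in the Euclidean norm for all $u^0$ and all $\tau\in(0,\tau_0]$. Suppose that the scheme has order $p\ge1$. Then: (a) The scheme is strongly stable with respect to $\mathcal L_{AS}^m$ for every $m\in\mathbb N_0$ with $2m+1\le p$. (b) Suppose in addition that $c_{p+1}$ is real and satisfies $$(-1)^{(p+1)/2}(1-c_{p+1})<0\ \text{ if } p \text{ is odd},\qquad 1+(-1)^{p/2}(c_{p+1}-1)\tbinom{p}{p/2}<0\ \text{ if } p\text{ is even}.$$ Then the scheme is not strongly stable with respect to $\mathcal L_{AS}$. (c) Under the hypotheses of (b), the scheme is not strongly stable with respect to $\{\mathbf L\}$ for any single $\mathbf L\in\mathcal L_{AS}$ with $2m_{HC}(\mathbf L)+1>p$.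 In particular, for every $m\in\mathbb N_0$ with $2m+1\le p$ it is strongly stable with respect to $\mathcal L_{AS}^m$ but not with respect to $\mathcal L_{AS}\setminus\mathcal L_{AS}^m$. -/

import Mathlib

open Matrix Filter Topology Asymptotics
open scoped ComplexOrder

noncomputable section

/-- An explicit Runge--Kutta scheme with `s` stages, weights `b i` and coefficients `a i j`.
Only the entries `a i j` with `j < i` are ever used. -/
structure ExplicitRK where
  s : ℕ
  a : Fin s → Fin s → ℂ
  b : Fin s → ℂ

namespace ExplicitRK

/-- The stages `K i = F (u + τ ∑_{j < i} a i j • K j)` of the scheme applied to `u' = F u`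
with time step `τ`, started at `u`. -/
def stage (M : ExplicitRK) {V : Type*} [AddCommGroup V] [Module ℂ V]
    (F : V →ₗ[ℂ] V) (τ : ℂ) (u : V) (i : Fin M.s) : V :=
  F (u + τ • ∑ j : Fin i.val,
    M.a i ⟨j.val, j.isLt.trans i.isLt⟩ • stage M F τ u ⟨j.val, j.isLt.trans i.isLt⟩)
termination_by i.val
decreasing_by exact j.isLt

/-- One step `u + τ ∑ i, b i • K i` of the scheme. -/
def step (M : ExplicitRK) {V : Type*} [AddCommGroup V] [Module ℂ V]
    (F : V →ₗ[ℂ] V) (τ : ℂ) (u : V) : V :=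
  u + τ • ∑ i : Fin M.s, M.b i • M.stage F τ u i

/-- One step of the scheme for the linear system `u' = L u` in `ℂⁿ`, with time step `τ`. -/
def matStep (M : ExplicitRK) {n : ℕ} (L : Matrix (Fin n) (Fin n) ℂ) (τ : ℝ)
    (u : EuclideanSpace ℂ (Fin n)) : EuclideanSpace ℂ (Fin n) :=
  M.step (Matrix.toEuclideanLin L) (τ : ℂ) u

/-- The stability function `R`: the result of one step for the scalar test equation `u' = z u`
with `u⁰ = 1` and unit time step, as a polynomial in `z`. -/
def stabilityFunction (M : ExplicitRK) : Polynomial ℂ :=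
  M.step (LinearMap.mulLeft ℂ (Polynomial.X : Polynomial ℂ)) 1 1

/-- The normalized coefficients `c j` in `R(z) = ∑ j, c j * z ^ j / j!`. -/
def stabilityCoeff (M : ExplicitRK) (j : ℕ) : ℂ :=
  (j.factorial : ℂ) * M.stabilityFunction.coeff j

/-- The scheme has order (at least) `p` for linear systems with constant coefficients: its local
error along every exact solution of every system `u' = L u` is `O(τ ^ (p + 1))`. -/
def HasOrder (M : ExplicitRK) (p : ℕ) : Prop :=
  ∀ (n : ℕ) (L : Matrix (Fin n) (Fin n) ℂ) (u : ℝ → EuclideanSpace ℂ (Fin n)),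
    (∀ t, HasDerivAt u (Matrix.toEuclideanLin L (u t)) t) →
      (fun τ : ℝ => u τ - M.matStep L τ (u 0)) =O[𝓝[>] 0] (fun τ : ℝ => τ ^ (p + 1))

/-- Strong stability with respect to a set `S` of (semi-dissipative) matrices of arbitrary
dimensions: for each `L ∈ S`, one step does not increase the Euclidean norm of any initial datum,
for all sufficiently small time steps (depending on `L` only). -/
def StronglyStableOn (M : ExplicitRK) (S : Set (Σ n : ℕ, Matrix (Fin n) (Fin n) ℂ)) : Prop :=
  ∀ L ∈ S, ∃ τ₀ : ℝ, 0 < τ₀ ∧ ∀ τ : ℝ, 0 < τ → τ ≤ τ₀ →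
    ∀ u : EuclideanSpace ℂ (Fin L.1), ‖M.matStep L.2 τ u‖ ≤ ‖u‖

end ExplicitRK

/-- The Hermitian part of a matrix. -/
def hermPart {n : ℕ} (L : Matrix (Fin n) (Fin n) ℂ) : Matrix (Fin n) (Fin n) ℂ :=
  (1 / 2 : ℂ) • (L + Lᴴ)

/-- The skew-Hermitian part of a matrix. -/
def skewPart {n : ℕ} (L : Matrix (Fin n) (Fin n) ℂ) : Matrix (Fin n) (Fin n) ℂ :=
  (1 / 2 : ℂ) • (L - Lᴴ)

/-- Semi-dissipativity: the Hermitian part is negative semi-definite. -/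
def IsSemiDissipative {n : ℕ} (L : Matrix (Fin n) (Fin n) ℂ) : Prop :=
  (-hermPart L).PosSemidef

/-- Asymptotic stability: all eigenvalues have negative real part. -/
def IsAsymptoticallyStable {n : ℕ} (L : Matrix (Fin n) (Fin n) ℂ) : Prop :=
  ∀ μ : ℂ, Module.End.HasEigenvalue (Matrix.toLin' L) μ → μ.re < 0

/-- The matrix `T_m = ∑_{j=0}^m L_S^j L_H (L_S^*)^j`. -/
def hcMatrix {n : ℕ} (L : Matrix (Fin n) (Fin n) ℂ) (m : ℕ) : Matrix (Fin n) (Fin n) ℂ :=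
  ∑ j ∈ Finset.range (m + 1), skewPart L ^ j * hermPart L * (skewPart L)ᴴ ^ j

/-- The hypocoercivity index: the smallest `m` such that `T_m` is negative definite
(and `⊤` if there is none). -/
def hcIndex {n : ℕ} (L : Matrix (Fin n) (Fin n) ℂ) : ℕ∞ :=
  sInf {k : ℕ∞ | ∃ m : ℕ, k = (m : ℕ∞) ∧ (-hcMatrix L m).PosDef}

/-- The set of asymptotically stable, semi-dissipative matrices of all dimensions. -/
def LAS : Set (Σ n : ℕ, Matrix (Fin n) (Fin n) ℂ) :=
  {L | IsAsymptoticallyStable L.2 ∧ IsSemiDissipative L.2}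

/-- The members of `LAS` with hypocoercivity index at most `m`. -/
def LASle (m : ℕ) : Set (Σ n : ℕ, Matrix (Fin n) (Fin n) ℂ) :=
  {L | L ∈ LAS ∧ hcIndex L.2 ≤ (m : ℕ∞)}

/-- The sign condition on `c = c_{p+1}`. All divisions by two are exact. -/
def SignCondition (p : ℕ) (c : ℝ) : Prop :=
  (Odd p ∧ (-1 : ℝ) ^ ((p + 1) / 2) * (1 - c) < 0) ∨
  (Even p ∧ 1 + (-1 : ℝ) ^ (p / 2) * (c - 1) * (p.choose (p / 2) : ℝ) < 0)

end

/-!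
Write `R` for the stability function, so that one step is `R(τL)`, and factor `L + L* = -2 B* B`.
Order `p` means that `R(τL)` agrees with `exp(τL)` up to `O(τ ^ (p + 1))`. As `L` and its
skew-Hermitian part agree on the kernel of `B`, the hypocoercivity index is at most `m` if and only
if no nonzero vector is annihilated by all of `B, B L, …, B L ^ m`.

If there is no such vector, the energy `‖exp(tL) u‖ ^ 2`, whose derivative is
`-2 ‖B exp(tL) u‖ ^ 2`, drops by at least `c τ ^ (2 m + 1) ‖u‖ ^ 2` during a step, which dominates
the error of the scheme when `2 m + 1 ≤ p`.

Otherwise let `k = ⌊(p + 1) / 2⌋`, let `D(-z) / D(z)` be the `(k, k)` Padé approximant of `exp z`,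
and choose `u` annihilated by `B, …, B L ^ (k - 1)` but not by `B L ^ k`; asymptotic stability
guarantees that `u` exists. Since `L` acts on `u` as a skew operator up to order `k`, the vectors
`D(τL) u` and `D(-τL) u` have the same norm. Multiplying the former by `R(τL)` gives the latter plus
a defect of order `p + 1`, and the sign condition says that the leading term of the defect makes the
norm grow.
-/

section StabilityFunction

open Polynomial

theorem toLinearMap_aeval {𝕜 E : Type*} [NormedField 𝕜] [SeminormedAddCommGroup E] [NormedSpace 𝕜 E]
    (L : E →L[𝕜] E) (q : 𝕜[X]) : ((aeval L q : E →L[𝕜] E) : E →ₗ[𝕜] E) = aeval (L : E →ₗ[𝕜] E) q :=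
  let toEnd : (E →L[𝕜] E) →ₐ[𝕜] Module.End 𝕜 E :=
    { ContinuousLinearMap.toLinearMapRingHom with commutes' := fun _ => rfl }
  (aeval_algHom_apply toEnd L q).symm

theorem ExplicitRK.aeval_stage (M : ExplicitRK) {V : Type*} [AddCommGroup V] [Module ℂ V]
    (F : Module.End ℂ V) (τ : ℂ) (u : V) (i : Fin M.s) :
    aeval (τ • F) (M.stage (LinearMap.mulLeft ℂ (X : ℂ[X])) 1 1 i) u = τ • M.stage F τ u i := by
  induction hi : i.val using Nat.strong_induction_on generalizing i with
  | _ k ih =>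
    subst hi
    rw [ExplicitRK.stage, ExplicitRK.stage]
    simp only [one_smul, LinearMap.mulLeft_apply, map_mul, aeval_X, map_add, map_one, map_sum,
      map_smul, Module.End.mul_apply, LinearMap.add_apply, Module.End.one_apply,
      LinearMap.sum_apply, LinearMap.smul_apply]
    rw [smul_add, Finset.smul_sum, Finset.smul_sum]
    congr 1
    refine Finset.sum_congr rfl fun j _ => ?_
    rw [ih j.val j.isLt ⟨j.val, j.isLt.trans i.isLt⟩ rfl]
    simp only [map_smul, smul_comm (M.a i _) τ]

theorem ExplicitRK.step_eq_aeval (M : ExplicitRK) {V : Type*} [AddCommGroup V] [Module ℂ V]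
    (F : Module.End ℂ V) (τ : ℂ) (u : V) :
    M.step F τ u = aeval (τ • F) M.stabilityFunction u := by
  simp only [stabilityFunction, step, one_smul, map_add, map_one, map_sum, map_smul,
    LinearMap.add_apply, Module.End.one_apply, LinearMap.sum_apply, LinearMap.smul_apply,
    aeval_stage, Finset.smul_sum]
  simp only [smul_comm τ]

theorem ExplicitRK.matStep_eq_aeval (M : ExplicitRK) {n : ℕ} (L : Matrix (Fin n) (Fin n) ℂ) (τ : ℝ)
    (u : EuclideanSpace ℂ (Fin n)) :
    M.matStep L τ u =
      aeval ((τ : ℂ) • toEuclideanCLM (n := Fin n) (𝕜 := ℂ) L) M.stabilityFunction u := by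
  rw [matStep, step_eq_aeval, ← coe_toEuclideanCLM_eq_toEuclideanLin,
    ← ContinuousLinearMap.toLinearMap_smul, ← toLinearMap_aeval]
  rfl

theorem ExplicitRK.stronglyStableOn_iff (M : ExplicitRK)
    (S : Set (Σ n : ℕ, Matrix (Fin n) (Fin n) ℂ)) :
    M.StronglyStableOn S ↔ ∀ L ∈ S, ∀ᶠ τ : ℝ in 𝓝[>] 0,
      ‖aeval ((τ : ℂ) • toEuclideanCLM (n := Fin L.1) (𝕜 := ℂ) L.2) M.stabilityFunction‖ ≤ 1 := by
  simp only [StronglyStableOn, matStep_eq_aeval, Filter.Eventually,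
    mem_nhdsGT_iff_exists_Ioc_subset, Set.subset_def, Set.mem_Ioc, Set.mem_Ioi, Set.mem_ofPred_eq,
    and_imp, ContinuousLinearMap.opNorm_le_iff zero_le_one, one_mul]

theorem ExplicitRK.StronglyStableOn.mono {M : ExplicitRK}
    {S T : Set (Σ n : ℕ, Matrix (Fin n) (Fin n) ℂ)} (h : M.StronglyStableOn T) (hST : S ⊆ T) :
    M.StronglyStableOn S := fun L hL => h L (hST hL)

end StabilityFunction

section ExpComparison

open Polynomial

theorem exp_sub_aeval_isBigO {A : Type*} [NormedRing A] [NormedAlgebra ℂ A] [CompleteSpace A]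
    {q : ℂ[X]} {N : ℕ} (hq : ∀ j < N, q.coeff j = (j.factorial : ℂ)⁻¹) :
    (fun y : A => NormedSpace.exp y - aeval y q) =O[𝓝 0] fun y => ‖y‖ ^ N := by
  set T : ℂ[X] := ∑ j ∈ Finset.range N, monomial j (j.factorial : ℂ)⁻¹
  have hT : (fun y : A => NormedSpace.exp y - aeval y T) =O[𝓝 0] fun y => ‖y‖ ^ N := by
    refine ((NormedSpace.exp_hasFPowerSeriesAt_zero (𝕂 := ℂ)
      (𝔸 := A)).isBigO_sub_partialSum_pow N).congr_left fun y => ?_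
    simp only [zero_add, FormalMultilinearSeries.partialSum, NormedSpace.expSeries_apply_eq, T,
      map_sum, aeval_monomial, Algebra.smul_def]
  obtain ⟨Q, hQ⟩ : X ^ N ∣ T - q := X_pow_dvd_iff.2 fun j hj => by
    simp [T, coeff_monomial, hq j hj, hj]
  have hQ_bounded : (fun y : A => aeval y Q) =O[𝓝 0] fun _ => (1 : ℝ) :=
    (Polynomial.continuous_aeval Q).continuousAt.isBigO_one ℝ
  have hTq : (fun y : A => aeval y (T - q)) =O[𝓝 0] fun y => ‖y‖ ^ N := by
    simpa only [hQ, map_mul, map_pow, aeval_X, mul_one]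
      using ((isBigO_refl (fun y : A => y) (𝓝 0)).norm_right.pow N).mul hQ_bounded
  refine (hT.add hTq).congr_left fun y => ?_
  rw [map_sub]; abel

theorem exp_smul_sub_aeval_smul_isBigO {A : Type*} [NormedRing A] [NormedAlgebra ℂ A]
    [CompleteSpace A] (a : A) {q : ℂ[X]} {N : ℕ}
    (hq : ∀ j < N, q.coeff j = (j.factorial : ℂ)⁻¹) :
    (fun t : ℝ => NormedSpace.exp ((t : ℂ) • a) - aeval ((t : ℂ) • a) q) =O[𝓝 0]
      fun t => t ^ N := by
  have h_lim : Tendsto (fun t : ℝ => (t : ℂ) • a) (𝓝 0) (𝓝 0) :=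
    (Complex.continuous_ofReal.smul continuous_const).tendsto' _ _ (by simp)
  refine ((exp_sub_aeval_isBigO hq).comp_tendsto h_lim).trans ?_
  refine IsBigO.pow (.of_bound ‖a‖ (.of_forall fun t => ?_)) N
  simp [norm_smul, mul_comm]

theorem X_pow_dvd_of_eval_isBigO {𝕜 : Type*} [NormedField 𝕜] {Q : 𝕜[X]} {N : ℕ} {l : Filter 𝕜}
    [l.NeBot] (hl : l ≤ 𝓝[≠] 0) (h : (fun x => Q.eval x) =O[l] fun x => x ^ N) : X ^ N ∣ Q := by
  rcases eq_or_ne Q 0 with rfl | hQ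
  · exact dvd_zero _
  obtain ⟨Q₁, hQ₁, hX⟩ := exists_eq_pow_rootMultiplicity_mul_and_not_dvd Q hQ 0
  set n := Q.rootMultiplicity 0
  rw [C_0, sub_zero] at hQ₁ hX
  suffices N ≤ n from hQ₁ ▸ (pow_dvd_pow X this).mul_right Q₁
  by_contra! hn
  have hQ₁_O : (fun x => Q₁.eval x) =O[l] fun x => x ^ (N - n) := by
    refine ((isBigO_refl (fun x => (x ^ n)⁻¹) l).mul h).congr' ?_ ?_ <;>
      filter_upwards [hl self_mem_nhdsWithin] with x (hx : x ≠ 0)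
    · rw [hQ₁]
      simp [hx]
    · rw [pow_sub₀ x hx hn.le, mul_comm]
  have hl0 : l ≤ 𝓝 0 := hl.trans nhdsWithin_le_nhds
  have htendsto : Tendsto (fun x : 𝕜 => x ^ (N - n)) l (𝓝 0) := by
    have := ((continuous_pow (M := 𝕜) (N - n)).tendsto 0).mono_left hl0
    rwa [zero_pow (Nat.sub_ne_zero_of_lt hn)] at this
  have heval : Q₁.eval 0 = 0 :=
    tendsto_nhds_unique (Q₁.continuous.tendsto 0 |>.mono_left hl0) (hQ₁_O.trans_tendsto htendsto)
  exact hX (X_dvd_iff.2 (coeff_zero_eq_eval_zero Q₁ ▸ heval))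

theorem coeff_eq_inv_factorial_of_isBigO {R : ℂ[X]} {N : ℕ}
    (hR : (fun τ : ℝ => Complex.exp τ - R.eval (τ : ℂ)) =O[𝓝[>] 0] fun τ => τ ^ N)
    {j : ℕ} (hj : j < N) : R.coeff j = (j.factorial : ℂ)⁻¹ := by
  set T : ℂ[X] := (PowerSeries.exp ℂ).trunc N
  have hT_coeff (i : ℕ) (hi : i < N) : T.coeff i = (i.factorial : ℂ)⁻¹ := by
    simp [T, PowerSeries.coeff_trunc, PowerSeries.coeff_exp, hi]
  have h_ofReal : Tendsto (fun τ : ℝ => (τ : ℂ)) (𝓝[>] 0) (𝓝[≠] 0) :=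
    tendsto_nhdsWithin_of_tendsto_nhds_of_eventually_within _
      ((Complex.continuous_ofReal.tendsto' 0 0 Complex.ofReal_zero).mono_left nhdsWithin_le_nhds)
      (eventually_nhdsWithin_of_forall fun τ hτ => Complex.ofReal_ne_zero.2 (ne_of_gt hτ))
  have hT : (fun τ : ℝ => Complex.exp τ - T.eval (τ : ℂ)) =O[𝓝[>] 0] fun τ => τ ^ N := by
    simpa only [smul_eq_mul, mul_one, ← Complex.exp_eq_exp_ℂ, coe_aeval_eq_eval]
      using (exp_smul_sub_aeval_smul_isBigO (1 : ℂ) hT_coeff).mono nhdsWithin_le_nhds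
  have h_dvd : X ^ N ∣ R - T := by
    refine X_pow_dvd_of_eval_isBigO (l := map (fun τ : ℝ => (τ : ℂ)) (𝓝[>] 0)) h_ofReal
      (isBigO_map.2 ?_)
    refine ((hT.sub hR).congr_left fun τ => ?_).trans (isBigO_of_le _ fun τ => ?_) <;> simp
  rw [← hT_coeff j hj, ← sub_eq_zero, ← coeff_sub]
  exact X_pow_dvd_iff.1 h_dvd j hj

theorem ExplicitRK.HasOrder.coeff_stabilityFunction {M : ExplicitRK} {p : ℕ} (hM : M.HasOrder p)
    {j : ℕ} (hj : j < p + 1) : M.stabilityFunction.coeff j = (j.factorial : ℂ)⁻¹ := by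
  refine coeff_eq_inv_factorial_of_isBigO ?_ hj
  -- The scalar equation `u' = u` suffices.
  set e : EuclideanSpace ℂ (Fin 1) := EuclideanSpace.single 0 1
  have h_exp (t : ℝ) : HasDerivAt (fun t : ℝ => Complex.exp t • e)
      (toEuclideanLin (1 : Matrix (Fin 1) (Fin 1) ℂ) (Complex.exp t • e)) t := by
    rw [← coe_toEuclideanCLM_eq_toEuclideanLin, map_one]
    exact (Complex.hasDerivAt_exp t).comp_ofReal.smul_const e
  have h_step (τ : ℝ) : M.matStep 1 τ e = M.stabilityFunction.eval (τ : ℂ) • e := by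
    rw [M.matStep_eq_aeval, map_one, ← Algebra.algebraMap_eq_smul_one, aeval_algebraMap_apply,
      Algebra.algebraMap_eq_smul_one]
    simp
  refine (isBigO_of_le _ fun τ => ?_).trans (hM 1 1 _ h_exp)
  rw [Complex.ofReal_zero, Complex.exp_zero, one_smul, h_step, ← sub_smul, norm_smul]
  simp [e]

end ExpComparison

section ForwardDifference

theorem fwdDiff_iter_natCast_choose {R : Type*} [AddCommGroupWithOne R] (k m : ℕ) :
    (fwdDiff 1)^[k] (fun x : ℕ => (x.choose m : R)) =
      fun x => if k ≤ m then (x.choose (m - k) : R) else 0 := by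
  induction k with
  | zero => simp
  | succ k ih =>
    funext x
    rw [Function.iterate_succ_apply', ih, fwdDiff]
    rcases lt_trichotomy k m with h | rfl | h
    · obtain ⟨r, rfl⟩ := Nat.exists_eq_add_of_le (Nat.succ_le_of_lt h)
      rw [if_pos h.le, if_pos h.le, if_pos (Nat.succ_le_of_lt h), Nat.add_sub_cancel_left,
        show k + 1 + r - k = r + 1 by omega, Nat.choose_succ_succ, Nat.cast_add,
        add_sub_cancel_right]
    · simp
    · simp [h.not_ge, (Nat.lt_succ_of_lt h).not_ge]

theorem fwdDiff_iter_natCast_add_one_inv {𝕜 : Type*} [Field 𝕜] [CharZero 𝕜] (k : ℕ) :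
    (fwdDiff 1)^[k] (fun x : ℕ => ((x : 𝕜) + 1)⁻¹) =
      fun x => (-1) ^ k * (k.factorial : 𝕜) * x.factorial / (x + k + 1).factorial := by
  induction k with
  | zero =>
    funext x
    have : (x.factorial : 𝕜) ≠ 0 := Nat.cast_ne_zero.2 x.factorial_ne_zero
    simp [Nat.factorial_succ, div_mul_cancel_right₀ this]
  | succ k ih =>
    funext x
    have h_fact : ((x + k + 1).factorial : 𝕜) ≠ 0 := Nat.cast_ne_zero.2 (Nat.factorial_ne_zero _)
    have h_succ : ((x : 𝕜) + k + 1 + 1) ≠ 0 := by exact_mod_cast (x + k + 1).succ_ne_zero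
    rw [Function.iterate_succ_apply', ih, fwdDiff, show x + 1 + k + 1 = x + k + 1 + 1 by omega,
      ← add_assoc x k 1]
    simp only [Nat.factorial_succ (x + k + 1), Nat.factorial_succ k, Nat.factorial_succ x]
    push_cast
    field_simp
    ring

end ForwardDifference

section Pade

open Polynomial

/-- The denominator `D` of the diagonal `(k, k)` Padé approximant `D(-z) / D(z)` of `exp z`,
normalized by `D(0) = 1`. -/
noncomputable def padeDenom (k : ℕ) : ℝ[X] :=
  ∑ j ∈ Finset.range (k + 1),
    monomial j ((-1) ^ j * (k.choose j : ℝ) * (2 * k - j).factorial / (2 * k).factorial)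

theorem coeff_padeDenom (k n : ℕ) : (padeDenom k).coeff n =
    (-1) ^ n * (k.choose n : ℝ) * (2 * k - n).factorial / (2 * k).factorial := by
  simp only [padeDenom, finsetSum_coeff, coeff_monomial, Finset.sum_ite_eq', Finset.mem_range]
  split_ifs with h
  · rfl
  · simp [Nat.choose_eq_zero_of_lt (not_lt.1 h)]

theorem natDegree_padeDenom_le (k : ℕ) : (padeDenom k).natDegree ≤ k :=
  natDegree_le_iff_coeff_eq_zero.2 fun n hn => by
    simp [coeff_padeDenom, Nat.choose_eq_zero_of_lt hn]

theorem coeff_zero_padeDenom (k : ℕ) : (padeDenom k).coeff 0 = 1 := by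
  simp [coeff_padeDenom, Nat.factorial_ne_zero]

theorem coeff_comp_neg_X {R : Type*} [CommRing R] (q : R[X]) (n : ℕ) :
    (q.comp (-X)).coeff n = (-1) ^ n * q.coeff n := by
  rw [show (-X : R[X]) = C (-1) * X by simp, comp_C_mul_X_coeff, mul_comm]

/-- Reversing the order of summation turns the convolution into a `k`-th difference. -/
theorem coeff_padeDenom_mul_exp (k n : ℕ) :
    PowerSeries.coeff n ((padeDenom k : PowerSeries ℝ) * PowerSeries.exp ℝ) =
      ((2 * k).factorial : ℝ)⁻¹ * (fwdDiff 1)^[k] (fun x : ℕ =>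
        if 2 * k ≤ n + x then (x.factorial : ℝ) / (n + x - 2 * k).factorial else 0) k := by
  have h_conv : PowerSeries.coeff n ((padeDenom k : PowerSeries ℝ) * PowerSeries.exp ℝ) =
      ∑ j ∈ Finset.range (k + 1),
        (padeDenom k).coeff j * if j ≤ n then ((n - j).factorial : ℝ)⁻¹ else 0 := by
    conv_lhs =>
      rw [(padeDenom k).as_sum_range' (k + 1) (Nat.lt_succ_of_le (natDegree_padeDenom_le k))]
    rw [← coeToPowerSeries.ringHom_apply, map_sum, Finset.sum_mul, map_sum]
    refine Finset.sum_congr rfl fun j _ => ?_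
    rw [← C_mul_X_pow_eq_monomial, coeToPowerSeries.ringHom_apply, coe_mul, coe_C, coe_pow, coe_X,
      mul_assoc, PowerSeries.coeff_C_mul, PowerSeries.coeff_X_pow_mul']
    simp [PowerSeries.coeff_exp]
  rw [h_conv, fwdDiff_iter_eq_sum_shift, Finset.mul_sum, ← Finset.sum_flip]
  refine Finset.sum_congr rfl fun j hj => ?_
  have hjk : j ≤ k := Nat.lt_succ_iff.1 (Finset.mem_range.1 hj)
  rw [coeff_padeDenom, Nat.choose_symm hjk, show 2 * k - (k - j) = k + j by omega]
  simp only [smul_eq_mul, mul_one, zsmul_eq_mul, show 2 * k ≤ n + (k + j) ↔ k - j ≤ n by omega,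
    show n + (k + j) - 2 * k = n - (k - j) by omega]
  split_ifs <;> push_cast <;> ring

theorem coeff_padeDenom_mul_exp_of_le {k n : ℕ} (hn : n ≤ 2 * k) :
    PowerSeries.coeff n ((padeDenom k : PowerSeries ℝ) * PowerSeries.exp ℝ) =
      ((padeDenom k).comp (-X)).coeff n := by
  have h_choose : (fun x : ℕ => if 2 * k ≤ n + x then
      (x.factorial : ℝ) / (n + x - 2 * k).factorial else 0) =
      ((2 * k - n).factorial : ℝ) • fun x : ℕ => (x.choose (2 * k - n) : ℝ) := by
    funext x
    rw [Pi.smul_apply, smul_eq_mul]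
    split_ifs with hx
    · rw [Nat.cast_choose ℝ (show 2 * k - n ≤ x by omega),
        show x - (2 * k - n) = n + x - 2 * k by omega]
      field_simp
    · rw [Nat.choose_eq_zero_of_lt (by omega), Nat.cast_zero, mul_zero]
  rw [coeff_padeDenom_mul_exp, h_choose, fwdDiff_iter_const_smul, fwdDiff_iter_natCast_choose,
    coeff_comp_neg_X, coeff_padeDenom, Pi.smul_apply]
  have h_sq : ((-1 : ℝ) ^ n) * (-1) ^ n = 1 := by rw [← mul_pow]; simp
  have h_value : (if k ≤ 2 * k - n then (k.choose (2 * k - n - k) : ℝ) else 0) = k.choose n := by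
    split_ifs with hk
    · rw [show 2 * k - n - k = k - n by omega, Nat.choose_symm (by omega)]
    · rw [Nat.choose_eq_zero_of_lt (by omega), Nat.cast_zero]
  rw [h_value, smul_eq_mul]
  linear_combination (-(k.choose n : ℝ) * (2 * k - n).factorial / (2 * k).factorial) * h_sq

theorem coeff_padeDenom_mul_exp_two_mul_add_one (k : ℕ) :
    PowerSeries.coeff (2 * k + 1) ((padeDenom k : PowerSeries ℝ) * PowerSeries.exp ℝ) =
      (-1) ^ k / ((2 * k).choose k * (2 * k + 1).factorial) := by
  have h_inv : (fun x : ℕ => if 2 * k ≤ 2 * k + 1 + x then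
      (x.factorial : ℝ) / (2 * k + 1 + x - 2 * k).factorial else 0) =
      fun x : ℕ => ((x : ℝ) + 1)⁻¹ := by
    funext x
    rw [if_pos (by omega), show 2 * k + 1 + x - 2 * k = x + 1 by omega, Nat.factorial_succ]
    push_cast
    field_simp
  rw [coeff_padeDenom_mul_exp, h_inv, fwdDiff_iter_natCast_add_one_inv,
    Nat.cast_choose ℝ (show k ≤ 2 * k by omega), show 2 * k - k = k by omega]
  dsimp only
  rw [← two_mul]
  field_simp

theorem coeff_mul_of_coeff_eq {S : Type*} [CommRing S] {φ ψ : PowerSeries S} {N : ℕ}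
    (h : ∀ j < N, PowerSeries.coeff j φ = PowerSeries.coeff j ψ) (D : PowerSeries S) :
    (∀ j < N, PowerSeries.coeff j (φ * D) = PowerSeries.coeff j (ψ * D)) ∧
      PowerSeries.coeff N (φ * D) = PowerSeries.coeff N (ψ * D) +
        (PowerSeries.coeff N φ - PowerSeries.coeff N ψ) * PowerSeries.coeff 0 D := by
  obtain ⟨χ, hχ⟩ : PowerSeries.X ^ N ∣ φ - ψ :=
    PowerSeries.X_pow_dvd_iff.2 fun j hj => by rw [map_sub, h j hj, sub_self]
  obtain rfl : φ = ψ + PowerSeries.X ^ N * χ := by rw [← hχ, add_sub_cancel]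
  simp only [add_mul, mul_assoc, map_add, PowerSeries.coeff_X_pow_mul']
  refine ⟨fun j hj => by rw [if_neg hj.not_ge, add_zero], ?_⟩
  simp

/-- The leading coefficient of the defect `R(z) D(z) - D(-z)` at order `N`, when
`R(z) = ∑_{j < N} z ^ j / j! + c z ^ N / N! + ⋯`. -/
noncomputable def padeDefect (k N : ℕ) (c : ℝ) : ℝ :=
  (c - 1) / N.factorial +
    PowerSeries.coeff N ((padeDenom k : PowerSeries ℝ) * PowerSeries.exp ℝ) -
    ((padeDenom k).comp (-X)).coeff N

theorem exists_mul_padeDenom_eq {R : ℂ[X]} {k N : ℕ} {c : ℝ} (hN : N ≤ 2 * k + 1)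
    (hR : ∀ j < N, R.coeff j = (j.factorial : ℂ)⁻¹) (hc : (N.factorial : ℂ) * R.coeff N = c) :
    ∃ Q : ℂ[X], Q.coeff 0 = padeDefect k N c ∧
      R * (padeDenom k).map (algebraMap ℝ ℂ) =
        ((padeDenom k).comp (-X)).map (algebraMap ℝ ℂ) + X ^ N * Q := by
  set D : ℂ[X] := (padeDenom k).map (algebraMap ℝ ℂ)
  set D' : ℂ[X] := ((padeDenom k).comp (-X)).map (algebraMap ℝ ℂ)
  have h_exp (n : ℕ) : PowerSeries.coeff n (PowerSeries.exp ℂ * (D : PowerSeries ℂ)) =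
      ((PowerSeries.coeff n ((padeDenom k : PowerSeries ℝ) * PowerSeries.exp ℝ) : ℝ) : ℂ) := by
    rw [← PowerSeries.map_exp (algebraMap ℝ ℂ), polynomial_map_coe, ← map_mul,
      PowerSeries.coeff_map, mul_comm]
    rfl
  have hN_fact : (N.factorial : ℂ) ≠ 0 := Nat.cast_ne_zero.2 N.factorial_ne_zero
  obtain ⟨h_low, h_top⟩ := coeff_mul_of_coeff_eq (φ := (R : PowerSeries ℂ))
    (ψ := PowerSeries.exp ℂ) (fun j hj => by simp [hR j hj, PowerSeries.coeff_exp]) D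
  rw [← coe_mul, coeff_coe, h_exp] at h_top
  obtain ⟨Q, hQ⟩ : X ^ N ∣ R * D - D' := by
    refine X_pow_dvd_iff.2 fun j hj => ?_
    rw [coeff_sub, ← coeff_coe, coe_mul, h_low j hj, h_exp,
      coeff_padeDenom_mul_exp_of_le (by omega), coeff_map, sub_eq_zero]
    rfl
  refine ⟨Q, ?_, by rw [← hQ, add_sub_cancel]⟩
  have h_coeff : Q.coeff 0 = (R * D - D').coeff N := by rw [hQ, coeff_X_pow_mul']; simp
  rw [h_coeff, coeff_sub, h_top, padeDefect]
  simp only [D, D', coeff_coe, PowerSeries.coeff_exp, one_div, map_inv₀, map_natCast,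
    polynomial_map_coe, PowerSeries.coeff_map, coeff_zero_padeDenom, Complex.coe_algebraMap,
    Complex.ofReal_one, mul_one, coeff_map, Complex.ofReal_sub, Complex.ofReal_add,
    Complex.ofReal_div, ← hc, Complex.ofReal_natCast, sub_left_inj]
  field_simp
  ring

theorem SignCondition.padeDefect_of_odd {p : ℕ} {c : ℝ} (h : SignCondition p c) (hp : Odd p) :
    0 < (-1) ^ ((p + 1) / 2) * padeDefect ((p + 1) / 2) (p + 1) c := by
  rcases h with ⟨-, h⟩ | ⟨hp', -⟩
  · set k := (p + 1) / 2
    have h_two : p + 1 ≤ 2 * k := by obtain ⟨i, hi⟩ := hp; omega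
    rw [padeDefect, coeff_padeDenom_mul_exp_of_le h_two, add_sub_cancel_right, mul_div_assoc']
    exact div_pos (by linarith) (by positivity)
  · exact absurd hp' (Nat.not_even_iff_odd.2 hp)

theorem SignCondition.padeDefect_of_even {p : ℕ} {c : ℝ} (h : SignCondition p c) (hp : Even p) :
    (-1) ^ ((p + 1) / 2) * padeDefect ((p + 1) / 2) (p + 1) c < 0 := by
  rcases h with ⟨hp', -⟩ | ⟨-, h⟩
  · exact absurd hp (Nat.not_even_iff_odd.2 hp')
  · obtain ⟨k, rfl⟩ := hp.two_dvd
    have h_choose : (0 : ℝ) < (2 * k).choose k := by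
      exact_mod_cast Nat.choose_pos (show k ≤ 2 * k by omega)
    have h_sq : ((-1 : ℝ) ^ k) * (-1) ^ k = 1 := by rw [← mul_pow]; simp
    rw [show (2 * k) / 2 = k by omega] at h
    rw [show (2 * k + 1) / 2 = k by omega, padeDefect, coeff_padeDenom_mul_exp_two_mul_add_one,
      coeff_comp_neg_X, coeff_padeDenom, Nat.choose_eq_zero_of_lt (show k < 2 * k + 1 by omega)]
    have h_eq : (-1 : ℝ) ^ k * ((c - 1) / (2 * k + 1).factorial +
        (-1) ^ k / ((2 * k).choose k * (2 * k + 1).factorial)) =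
        (1 + (-1) ^ k * (c - 1) * (2 * k).choose k) /
          ((2 * k).choose k * (2 * k + 1).factorial) := by
      field_simp
      linear_combination h_sq
    simpa using h_eq.trans_lt (div_neg_of_neg_of_pos h (by positivity))

end Pade

section Dissipation

variable {E F : Type*} [NormedAddCommGroup E] [InnerProductSpace ℂ E] [NormedAddCommGroup F]
  [InnerProductSpace ℂ F]

/-- `B` is a dissipation factor of `L` if `L + L* = -2 B* B`, stated through inner products so that
neither completeness nor adjoints are needed. -/
def IsDissipationFactor (L : E →L[ℂ] E) (B : E →L[ℂ] F) : Prop :=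
  ∀ x y, inner ℂ (L x) y + inner ℂ x (L y) = -2 * inner ℂ (B x) (B y)

/-- The vectors that the first `k` observations `B, B L, …, B L ^ (k - 1)` do not see. -/
def unobservableSubspace (L : E →L[ℂ] E) (B : E →L[ℂ] F) (k : ℕ) : Submodule ℂ E :=
  ⨅ j < k, (B ∘L L ^ j).ker

theorem mem_unobservableSubspace {L : E →L[ℂ] E} {B : E →L[ℂ] F} {k : ℕ} {x : E} :
    x ∈ unobservableSubspace L B k ↔ ∀ j < k, B ((L ^ j) x) = 0 := by
  simp only [unobservableSubspace, Submodule.mem_iInf, LinearMap.mem_ker]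
  rfl

theorem unobservableSubspace_antitone (L : E →L[ℂ] E) (B : E →L[ℂ] F) :
    Antitone (unobservableSubspace L B) := fun _ _ hkl =>
  biInf_mono fun _ hj => lt_of_lt_of_le hj hkl

theorem mem_unobservableSubspace_succ {L : E →L[ℂ] E} {B : E →L[ℂ] F} {k : ℕ} {x : E} :
    x ∈ unobservableSubspace L B (k + 1) ↔ B x = 0 ∧ L x ∈ unobservableSubspace L B k := by
  simp only [mem_unobservableSubspace, Nat.forall_lt_succ_left, pow_zero, pow_succ]
  rfl

theorem unobservableSubspace_congr {L L' : E →L[ℂ] E} {B : E →L[ℂ] F}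
    (h : ∀ x, B x = 0 → L x = L' x) (k : ℕ) :
    unobservableSubspace L B k = unobservableSubspace L' B k := by
  induction k with
  | zero => simp [unobservableSubspace]
  | succ k ih =>
    ext x
    rw [mem_unobservableSubspace_succ, mem_unobservableSubspace_succ, ih]
    exact and_congr_right fun hx => by rw [h x hx]

theorem unobservableSubspace_ne_bot [FiniteDimensional ℂ F] (L : E →L[ℂ] E) (B : E →L[ℂ] F) {k : ℕ}
    (hk : k * Module.finrank ℂ F < Module.finrank ℂ E) : unobservableSubspace L B k ≠ ⊥ := by
  have : FiniteDimensional ℂ E := FiniteDimensional.of_finrank_pos (Nat.zero_lt_of_lt hk)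
  let O : E →ₗ[ℂ] Fin k → F := LinearMap.pi fun j => (B ∘L L ^ j.val : E →ₗ[ℂ] F)
  obtain ⟨x, hx, hx_ne⟩ := O.ker.exists_mem_ne_zero_of_ne_bot
    (LinearMap.ker_ne_bot_of_finrank_lt (by simpa [Module.finrank_pi_fintype] using hk))
  refine (Submodule.ne_bot_iff _).2 ⟨x, mem_unobservableSubspace.2 fun j hj => ?_, hx_ne⟩
  exact congrFun (LinearMap.mem_ker.1 hx) ⟨j, hj⟩

namespace IsDissipationFactor

variable {L : E →L[ℂ] E} {B : E →L[ℂ] F}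

theorem re_inner_apply_self (h : IsDissipationFactor L B) (x : E) :
    (inner ℂ x (L x)).re = -‖B x‖ ^ 2 := by
  have h_norm : (inner ℂ (B x) (B x)).re = ‖B x‖ ^ 2 := inner_self_eq_norm_sq (𝕜 := ℂ) _
  have h_re := congrArg Complex.re (h x x)
  rw [Complex.add_re, ← inner_conj_symm (L x) x, Complex.conj_re, ← Complex.ofReal_ofNat,
    ← Complex.ofReal_neg, Complex.re_ofReal_mul, h_norm] at h_re
  linarith

theorem re_mul_norm_sq_of_apply_eq_smul (h : IsDissipationFactor L B) {μ : ℂ} {x : E}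
    (hx : L x = μ • x) : μ.re * ‖x‖ ^ 2 = -‖B x‖ ^ 2 := by
  rw [← h.re_inner_apply_self, hx, inner_smul_right, inner_self_eq_norm_sq_to_K, mul_comm,
    ← Complex.re_ofReal_mul, Complex.ofReal_pow, mul_comm]
  rfl

theorem re_neg_of_hasEigenvalue (h : IsDissipationFactor L B) {μ : ℂ}
    (hB : ∀ x, L x = μ • x → B x = 0 → x = 0)
    (hμ : Module.End.HasEigenvalue (L : E →ₗ[ℂ] E) μ) : μ.re < 0 := by
  obtain ⟨x, hx⟩ := hμ.exists_hasEigenvector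
  have hLx : L x = μ • x := hx.apply_eq_smul
  have hBx : B x ≠ 0 := fun h0 => hx.2 (hB x hLx h0)
  have h_neg : μ.re * ‖x‖ ^ 2 < 0 := by
    rw [h.re_mul_norm_sq_of_apply_eq_smul hLx, neg_lt_zero]
    positivity
  exact neg_of_mul_neg_left h_neg (sq_nonneg _)

theorem inner_pow_apply_pow_apply (h : IsDissipationFactor L B) {u : E} {k : ℕ}
    (hu : u ∈ unobservableSubspace L B k) {i : ℕ} (hi : i ≤ k) (j : ℕ) :
    inner ℂ ((L ^ i) u) ((L ^ j) u) = (-1) ^ i * inner ℂ u ((L ^ (i + j)) u) := by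
  induction i generalizing j with
  | zero => simp
  | succ i ih =>
    have h_skew := h ((L ^ i) u) ((L ^ j) u)
    rw [mem_unobservableSubspace.1 hu i hi, inner_zero_left, mul_zero,
      ← mul_apply_eq_comp, ← pow_succ', ← mul_apply_eq_comp, ← pow_succ',
      ih (Nat.le_of_succ_le hi) (j + 1)] at h_skew
    rw [eq_neg_of_add_eq_zero_left h_skew, pow_succ, Nat.succ_add_eq_add_succ]
    ring

theorem re_inner_pow_two_mul (h : IsDissipationFactor L B) {u : E} {k : ℕ}
    (hu : u ∈ unobservableSubspace L B k) :
    (inner ℂ u ((L ^ (2 * k)) u)).re = (-1) ^ k * ‖(L ^ k) u‖ ^ 2 := by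
  have h_sq : ((-1 : ℝ) ^ k) * (-1) ^ k = 1 := by rw [← mul_pow]; simp
  have h_re : ‖(L ^ k) u‖ ^ 2 = (-1) ^ k * (inner ℂ u ((L ^ (2 * k)) u)).re := by
    rw [two_mul, ← inner_self_eq_norm_sq (𝕜 := ℂ), h.inner_pow_apply_pow_apply hu le_rfl k,
      ← Complex.re_ofReal_mul]
    push_cast
    rfl
  rw [h_re, ← mul_assoc, h_sq, one_mul]

theorem re_inner_pow_two_mul_add_one (h : IsDissipationFactor L B) {u : E} {k : ℕ}
    (hu : u ∈ unobservableSubspace L B k) :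
    (inner ℂ u ((L ^ (2 * k + 1)) u)).re = -((-1) ^ k * ‖B ((L ^ k) u)‖ ^ 2) := by
  have h_sq : ((-1 : ℝ) ^ k) * (-1) ^ k = 1 := by rw [← mul_pow]; simp
  have h_re : -‖B ((L ^ k) u)‖ ^ 2 = (-1) ^ k * (inner ℂ u ((L ^ (2 * k + 1)) u)).re := by
    rw [← h.re_inner_apply_self, ← mul_apply_eq_comp, ← pow_succ',
      h.inner_pow_apply_pow_apply hu le_rfl (k + 1), ← Complex.re_ofReal_mul, two_mul, add_assoc]
    push_cast
    rfl
  rw [← mul_neg, h_re, ← mul_assoc, h_sq, one_mul]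

end IsDissipationFactor

end Dissipation

section Instability

open Polynomial

variable {E F : Type*} [NormedAddCommGroup E] [InnerProductSpace ℂ E] [NormedAddCommGroup F]
  [InnerProductSpace ℂ F] {L : E →L[ℂ] E} {B : E →L[ℂ] F}

theorem aeval_smul_map_apply {q : ℝ[X]} {n : ℕ} (hq : q.natDegree < n) (L : E →L[ℂ] E) (τ : ℝ)
    (u : E) : aeval ((τ : ℂ) • L) (q.map (algebraMap ℝ ℂ)) u =
      ∑ j ∈ Finset.range n, ((q.coeff j * τ ^ j : ℝ) : ℂ) • (L ^ j) u := by
  rw [aeval_eq_sum_range' (natDegree_map_le.trans_lt hq), _root_.sum_apply]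
  refine Finset.sum_congr rfl fun j _ => ?_
  rw [_root_.smul_pow, coeff_map, _root_.smul_apply, _root_.smul_apply, smul_smul]
  push_cast
  rfl

theorem continuous_aeval_smul_apply (L : E →L[ℂ] E) (q : ℂ[X]) (u : E) :
    Continuous fun t : ℝ => aeval ((t : ℂ) • L) q u :=
  ((Polynomial.continuous_aeval q).comp (by fun_prop)).clm_apply continuous_const

/-- Tested against unobservable vectors, `L` is skew. -/
theorem IsDissipationFactor.norm_aeval_comp_neg_X (h : IsDissipationFactor L B) {q : ℝ[X]} {k : ℕ}
    (hq : q.natDegree ≤ k) {u : E} (hu : u ∈ unobservableSubspace L B k) (τ : ℝ) :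
    ‖aeval ((τ : ℂ) • L) ((q.comp (-X)).map (algebraMap ℝ ℂ)) u‖ =
      ‖aeval ((τ : ℂ) • L) (q.map (algebraMap ℝ ℂ)) u‖ := by
  have hq' : (q.comp (-X)).natDegree < k + 1 := by
    rw [natDegree_comp, natDegree_neg, natDegree_X, mul_one]
    exact Nat.lt_succ_of_le hq
  rw [aeval_smul_map_apply hq', aeval_smul_map_apply (Nat.lt_succ_of_le hq),
    @norm_eq_sqrt_re_inner ℂ, @norm_eq_sqrt_re_inner ℂ]
  congr 2
  simp only [sum_inner, inner_sum, inner_smul_left, inner_smul_right, Complex.conj_ofReal,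
    Finset.mul_sum]
  rw [Finset.sum_comm]
  refine Finset.sum_congr rfl fun i hi => Finset.sum_congr rfl fun j hj => ?_
  rw [h.inner_pow_apply_pow_apply hu (Finset.mem_range_succ_iff.1 hj),
    h.inner_pow_apply_pow_apply hu (Finset.mem_range_succ_iff.1 hi), add_comm j i,
    coeff_comp_neg_X, coeff_comp_neg_X]
  have h_sq : ((-1 : ℂ) ^ i) * (-1) ^ i = 1 := by rw [← mul_pow]; simp
  simp only [Complex.ofReal_mul, Complex.ofReal_pow, Complex.ofReal_neg, Complex.ofReal_one]
  linear_combination ((-1) ^ j * q.coeff i * τ ^ i * (q.coeff j * τ ^ j) *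
    inner ℂ u ((L ^ (i + j)) u)) * h_sq

theorem eventually_norm_lt_norm_add_pow_smul {v w : ℝ → E} (hv : ContinuousAt v 0)
    (hw : ContinuousAt w 0) (h : 0 < (inner ℂ (v 0) (w 0)).re) (N : ℕ) :
    ∀ᶠ τ : ℝ in 𝓝[>] 0, ‖v τ‖ < ‖v τ + (τ : ℂ) ^ N • w τ‖ := by
  have h_pos : ∀ᶠ τ : ℝ in 𝓝[>] 0, 0 < (inner ℂ (v τ) (w τ)).re :=
    ((Complex.continuous_re.continuousAt.comp (hv.inner hw)).eventually_const_lt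
      h).filter_mono nhdsWithin_le_nhds
  filter_upwards [h_pos, self_mem_nhdsWithin] with τ hτ_pos (hτ : 0 < τ)
  refine lt_of_pow_lt_pow_left₀ 2 (norm_nonneg _) ?_
  have h_cross : RCLike.re (inner ℂ (v τ) ((τ : ℂ) ^ N • w τ)) =
      τ ^ N * (inner ℂ (v τ) (w τ)).re := by
    rw [inner_smul_right, ← Complex.ofReal_pow]
    exact Complex.re_ofReal_mul _ _
  rw [norm_add_sq (𝕜 := ℂ), h_cross, add_assoc]
  exact lt_add_of_pos_right _ (by positivity)

theorem IsDissipationFactor.eventually_one_lt_norm_aeval (h : IsDissipationFactor L B)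
    {R Q : ℂ[X]} {D : ℝ[X]} {k N : ℕ} {u : E} (hD : D.natDegree ≤ k) (hD_zero : D.coeff 0 = 1)
    (hR : R * D.map (algebraMap ℝ ℂ) = (D.comp (-X)).map (algebraMap ℝ ℂ) + X ^ N * Q)
    (hu : u ∈ unobservableSubspace L B k) (hQ : 0 < (Q.coeff 0 * inner ℂ u ((L ^ N) u)).re) :
    ∀ᶠ τ : ℝ in 𝓝[>] 0, 1 < ‖aeval ((τ : ℂ) • L) R‖ := by
  have h_zero (q : ℂ[X]) (x : E) : aeval (((0 : ℝ) : ℂ) • L) q x = q.coeff 0 • x := by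
    rw [Complex.ofReal_zero, zero_smul, ← coeff_zero_eq_aeval_zero', Algebra.algebraMap_eq_smul_one,
      _root_.smul_apply, one_apply_eq_self]
  set v : ℝ → E := fun τ => aeval ((τ : ℂ) • L) ((D.comp (-X)).map (algebraMap ℝ ℂ)) u
  set w : ℝ → E := fun τ => aeval ((τ : ℂ) • L) Q ((L ^ N) u)
  have h_inner : 0 < (inner ℂ (v 0) (w 0)).re := by
    simpa only [v, w, h_zero, coeff_map, coeff_comp_neg_X, hD_zero, pow_zero, one_mul, map_one,
      one_smul, inner_smul_right] using hQ
  filter_upwards [eventually_norm_lt_norm_add_pow_smul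
    (continuous_aeval_smul_apply L _ u).continuousAt
    (continuous_aeval_smul_apply L Q _).continuousAt h_inner N] with τ hτ
  by_contra! hR_le
  refine hτ.not_ge ?_
  calc ‖v τ + (τ : ℂ) ^ N • w τ‖
      = ‖aeval ((τ : ℂ) • L) R (aeval ((τ : ℂ) • L) (D.map (algebraMap ℝ ℂ)) u)‖ := by
        rw [← mul_apply_eq_comp, ← map_mul, hR, mul_comm (X ^ N), map_add, map_mul, map_pow,
          aeval_X, _root_.smul_pow]
        simp [v, w]
    _ ≤ ‖aeval ((τ : ℂ) • L) (D.map (algebraMap ℝ ℂ)) u‖ := by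
        simpa only [one_mul] using ContinuousLinearMap.le_of_opNorm_le _ hR_le _
    _ = ‖v τ‖ := (h.norm_aeval_comp_neg_X hD hu τ).symm

theorem IsDissipationFactor.eq_bot_of_le_comap [FiniteDimensional ℂ E] (h : IsDissipationFactor L B)
    (hL : ∀ μ : ℂ, Module.End.HasEigenvalue (L : E →ₗ[ℂ] E) μ → μ.re < 0) {W : Submodule ℂ E}
    (hW : W ≤ W.comap (L : E →ₗ[ℂ] E)) (hWB : W ≤ B.ker) : W = ⊥ := by
  by_contra hW_ne
  have : Nontrivial W := Submodule.nontrivial_iff_ne_bot.2 hW_ne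
  obtain ⟨μ, hμ⟩ := Module.End.exists_eigenvalue ((L : E →ₗ[ℂ] E).restrict hW)
  obtain ⟨x, hx⟩ := hμ.exists_hasEigenvector
  have hLx : L x = μ • (x : E) := congrArg Subtype.val hx.apply_eq_smul
  have hx_ne : (x : E) ≠ 0 := fun h0 => hx.2 (Subtype.ext h0)
  have hμ_neg : μ.re < 0 :=
    hL μ (Module.End.hasEigenvalue_of_hasEigenvector
      ⟨Module.End.mem_eigenspace_iff.2 hLx, hx_ne⟩)
  have h_energy := h.re_mul_norm_sq_of_apply_eq_smul hLx
  rw [show B (x : E) = 0 from hWB x.2, norm_zero, zero_pow two_ne_zero, neg_zero] at h_energy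
  exact (mul_neg_of_neg_of_pos hμ_neg (by positivity)).ne h_energy

theorem IsDissipationFactor.exists_mem_unobservableSubspace_apply_pow_ne_zero
    [FiniteDimensional ℂ E] (h : IsDissipationFactor L B)
    (hL : ∀ μ : ℂ, Module.End.HasEigenvalue (L : E →ₗ[ℂ] E) μ → μ.re < 0) {k : ℕ}
    (hk : unobservableSubspace L B k ≠ ⊥) :
    ∃ u ∈ unobservableSubspace L B k, B ((L ^ k) u) ≠ 0 := by
  by_contra! h_zero
  have h_succ (x : E) (hx : x ∈ unobservableSubspace L B k) :
      B x = 0 ∧ L x ∈ unobservableSubspace L B k := by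
    refine mem_unobservableSubspace_succ.1 (mem_unobservableSubspace.2 fun j hj => ?_)
    rcases Nat.lt_succ_iff_lt_or_eq.1 hj with hj | rfl
    · exact mem_unobservableSubspace.1 hx j hj
    · exact h_zero x hx
  exact hk (h.eq_bot_of_le_comap hL (fun x hx => (h_succ x hx).2) fun x hx => (h_succ x hx).1)

theorem IsDissipationFactor.eventually_one_lt_norm_aeval_of_signCondition [FiniteDimensional ℂ E]
    (h : IsDissipationFactor L B)
    (hL : ∀ μ : ℂ, Module.End.HasEigenvalue (L : E →ₗ[ℂ] E) μ → μ.re < 0) {R : ℂ[X]} {p : ℕ} {c : ℝ}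
    (hR : ∀ j < p + 1, R.coeff j = (j.factorial : ℂ)⁻¹)
    (hc : ((p + 1).factorial : ℂ) * R.coeff (p + 1) = c) (hs : SignCondition p c)
    (hU : unobservableSubspace L B ((p + 1) / 2) ≠ ⊥) :
    ∀ᶠ τ : ℝ in 𝓝[>] 0, 1 < ‖aeval ((τ : ℂ) • L) R‖ := by
  obtain ⟨u, hu, hBu⟩ := h.exists_mem_unobservableSubspace_apply_pow_ne_zero hL hU
  obtain ⟨Q, hQ_zero, hQ⟩ :=
    exists_mul_padeDenom_eq (k := (p + 1) / 2) (by omega) hR hc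
  refine h.eventually_one_lt_norm_aeval (natDegree_padeDenom_le _) (coeff_zero_padeDenom _) hQ hu ?_
  rw [hQ_zero, Complex.re_ofReal_mul]
  rcases Nat.even_or_odd p with hp | hp
  · have h_sign := hs.padeDefect_of_even hp
    have h_index : p + 1 = 2 * ((p + 1) / 2) + 1 := by obtain ⟨i, rfl⟩ := hp; omega
    have h_inner := h.re_inner_pow_two_mul_add_one hu
    rw [← h_index] at h_inner
    have h_pos : 0 < ‖B ((L ^ ((p + 1) / 2)) u)‖ ^ 2 := by positivity
    rw [h_inner]
    linarith [mul_neg_of_neg_of_pos h_sign h_pos]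
  · have h_sign := hs.padeDefect_of_odd hp
    have h_index : p + 1 = 2 * ((p + 1) / 2) := by obtain ⟨i, rfl⟩ := hp; omega
    have h_inner := h.re_inner_pow_two_mul hu
    rw [← h_index] at h_inner
    have h_ne : (L ^ ((p + 1) / 2)) u ≠ 0 := fun h0 => hBu (by rw [h0, map_zero])
    have h_pos : 0 < ‖(L ^ ((p + 1) / 2)) u‖ ^ 2 := by positivity
    rw [h_inner]
    linarith [mul_pos h_sign h_pos]

end Instability

section Coercivity

theorem exists_pos_mul_norm_sq_le {V : Type*} [NormedAddCommGroup V] [NormedSpace ℝ V]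
    [ProperSpace V] {f : V → ℝ} (hf : Continuous f) (hf_smul : ∀ (r : ℝ) x, f (r • x) = r ^ 2 * f x)
    (hf_pos : ∀ x, x ≠ 0 → 0 < f x) : ∃ c : ℝ, 0 < c ∧ ∀ x, c * ‖x‖ ^ 2 ≤ f x := by
  have hf_zero : f 0 = 0 := by simpa using hf_smul 0 0
  rcases subsingleton_or_nontrivial V with _ | _
  · exact ⟨1, one_pos, fun x => by simp [Subsingleton.elim x 0, hf_zero]⟩
  obtain ⟨y, hy, hy_min⟩ := (isCompact_sphere (0 : V) 1).exists_isMinOn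
    (NormedSpace.sphere_nonempty.2 zero_le_one) hf.continuousOn
  refine ⟨f y, hf_pos y (ne_zero_of_mem_unit_sphere ⟨y, hy⟩), fun x => ?_⟩
  rcases eq_or_ne x 0 with rfl | hx
  · simp [hf_zero]
  · have h_min : f y ≤ f (‖x‖⁻¹ • x) := hy_min (by simp [norm_smul, hx])
    rwa [hf_smul, inv_pow, inv_mul_eq_div, le_div_iff₀ (by positivity)] at h_min

variable {F : Type*} [NormedAddCommGroup F] [InnerProductSpace ℂ F]

theorem eq_zero_of_sum_pow_smul_eq_zero {n : ℕ} {x : Fin n → F} {S : Set ℂ} (hS : S.Infinite)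
    (h : ∀ s ∈ S, ∑ j, s ^ j.val • x j = 0) : x = 0 := by
  funext i
  have h_poly : ∑ j : Fin n, Polynomial.monomial j.val (inner ℂ (x i) (x j)) = 0 := by
    refine Polynomial.eq_zero_of_infinite_isRoot _ (hS.mono fun s hs => ?_)
    simpa [Polynomial.IsRoot, Polynomial.eval_finsetSum, inner_sum, inner_smul_right, mul_comm]
      using congrArg (inner ℂ (x i)) (h s hs)
  have h_coeff := congrArg (fun P => Polynomial.coeff P i.val) h_poly
  simpa [Polynomial.finsetSum_coeff, Polynomial.coeff_monomial, Fin.val_inj] using h_coeff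

variable [FiniteDimensional ℂ F]

theorem exists_pos_mul_norm_sq_le_integral_sum_pow_smul (n : ℕ) :
    ∃ c : ℝ, 0 < c ∧ ∀ x : Fin n → F,
      c * ‖x‖ ^ 2 ≤ ∫ s in (0 : ℝ)..1, ‖∑ j, (s : ℂ) ^ j.val • x j‖ ^ 2 := by
  have : ProperSpace F := FiniteDimensional.proper ℂ F
  refine exists_pos_mul_norm_sq_le ?_ (fun r x => ?_) fun x hx => ?_
  · exact intervalIntegral.continuous_parametric_intervalIntegral_of_continuous' (by fun_prop) 0 1
  · rw [← intervalIntegral.integral_const_mul]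
    refine intervalIntegral.integral_congr fun s _ => ?_
    simp only [Pi.smul_apply, smul_comm _ r, ← Finset.smul_sum, norm_smul, mul_pow,
      Real.norm_eq_abs, sq_abs]
  · refine intervalIntegral.integral_pos zero_lt_one (by fun_prop) (fun s _ => by positivity) ?_
    by_contra! h_nonpos
    refine hx (eq_zero_of_sum_pow_smul_eq_zero ((Set.Icc_infinite (zero_lt_one' ℝ)).image
      Complex.ofReal_injective.injOn) ?_)
    rintro _ ⟨s, hs, rfl⟩
    simpa using le_antisymm (h_nonpos s hs) (by positivity)

theorem exists_pos_mul_pow_mul_norm_sq_le_integral_sum_pow_smul (m : ℕ) :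
    ∃ c : ℝ, 0 < c ∧ ∀ (x : Fin (m + 1) → F) (τ : ℝ), 0 < τ → τ ≤ 1 →
      c * τ ^ (2 * m + 1) * ‖x‖ ^ 2 ≤ ∫ t in (0 : ℝ)..τ, ‖∑ j, (t : ℂ) ^ j.val • x j‖ ^ 2 := by
  obtain ⟨c, hc, hc_le⟩ := exists_pos_mul_norm_sq_le_integral_sum_pow_smul (F := F) (m + 1)
  refine ⟨c, hc, fun x τ hτ hτ_one => ?_⟩
  set y : Fin (m + 1) → F := fun j => (τ : ℂ) ^ j.val • x j
  have hy (s : ℝ) : ∑ j, (s : ℂ) ^ j.val • y j =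
      ∑ j, ((τ * s : ℝ) : ℂ) ^ j.val • x j := by
    simp only [y, smul_smul, Complex.ofReal_mul, mul_pow, mul_comm]
  have h_norm : τ ^ m * ‖x‖ ≤ ‖y‖ := by
    rw [← le_div_iff₀' (by positivity), pi_norm_le_iff_of_nonneg (by positivity)]
    intro j
    rw [le_div_iff₀' (by positivity)]
    refine le_trans ?_ (norm_le_pi_norm y j)
    rw [norm_smul, norm_pow, Complex.norm_real, Real.norm_of_nonneg hτ.le]
    gcongr ?_ * _
    exact pow_le_pow_of_le_one hτ.le hτ_one (Nat.lt_succ_iff.1 j.isLt)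
  have h_subst := intervalIntegral.smul_integral_comp_mul_left (a := 0) (b := 1)
    (fun t : ℝ => ‖∑ j, (t : ℂ) ^ j.val • x j‖ ^ 2) τ
  rw [mul_zero, mul_one] at h_subst
  calc c * τ ^ (2 * m + 1) * ‖x‖ ^ 2 = τ * (c * (τ ^ m * ‖x‖) ^ 2) := by ring
    _ ≤ τ * (c * ‖y‖ ^ 2) := by gcongr
    _ ≤ τ * ∫ s in (0 : ℝ)..1, ‖∑ j, (s : ℂ) ^ j.val • y j‖ ^ 2 := by gcongr; exact hc_le y
    _ = _ := by simp only [hy, ← h_subst, smul_eq_mul]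

end Coercivity

theorem integral_norm_sq_le_of_norm_sub_le {F : Type*} [NormedAddCommGroup F] {f g : ℝ → F}
    {a b δ : ℝ} (hab : a ≤ b) (hf : Continuous f) (hg : Continuous g)
    (hfg : ∀ t ∈ Set.Icc a b, ‖f t - g t‖ ≤ δ) :
    ∫ t in a..b, ‖f t‖ ^ 2 ≤ 2 * (∫ t in a..b, ‖g t‖ ^ 2) + 2 * ((b - a) * δ ^ 2) := by
  have h_le (t : ℝ) (ht : t ∈ Set.Icc a b) : ‖f t‖ ^ 2 ≤ 2 * ‖g t‖ ^ 2 + 2 * δ ^ 2 := by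
    calc ‖f t‖ ^ 2 ≤ (‖g t‖ + δ) ^ 2 := by
          gcongr
          exact (norm_le_norm_add_norm_sub' _ _).trans (by gcongr; exact hfg t ht)
      _ ≤ 2 * ‖g t‖ ^ 2 + 2 * δ ^ 2 := by linarith [add_sq_le (a := ‖g t‖) (b := δ)]
  have hg_int : IntervalIntegrable (fun t => 2 * ‖g t‖ ^ 2) MeasureTheory.volume a b :=
    (by fun_prop : Continuous fun t => 2 * ‖g t‖ ^ 2).intervalIntegrable a b
  calc ∫ t in a..b, ‖f t‖ ^ 2 ≤ ∫ t in a..b, (2 * ‖g t‖ ^ 2 + 2 * δ ^ 2) :=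
        intervalIntegral.integral_mono_on hab ((hf.norm.pow 2).intervalIntegrable a b)
          (hg_int.add intervalIntegrable_const) h_le
    _ = 2 * (∫ t in a..b, ‖g t‖ ^ 2) + 2 * ((b - a) * δ ^ 2) := by
        rw [intervalIntegral.integral_add hg_int intervalIntegrable_const,
          intervalIntegral.integral_const_mul, intervalIntegral.integral_const, smul_eq_mul]
        ring

theorem exists_eventually_forall_mem_Icc_norm_le {V : Type*} [NormedAddCommGroup V] {f : ℝ → V}
    {N : ℕ} (hf : f =O[𝓝 0] fun t => t ^ N) :
    ∃ C : ℝ, ∀ᶠ τ : ℝ in 𝓝[>] 0, ∀ t ∈ Set.Icc 0 τ, ‖f t‖ ≤ C * τ ^ N := by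
  obtain ⟨C, hC, hfC⟩ := hf.exists_nonneg
  obtain ⟨ε, hε, hfε⟩ := Metric.eventually_nhds_iff.1 hfC.bound
  refine ⟨C, ?_⟩
  filter_upwards [Ioo_mem_nhdsGT hε] with τ ⟨_, hτ_lt⟩ t ⟨ht, htτ⟩
  have h_dist : dist t 0 < ε := by rw [Real.dist_0_eq_abs, abs_of_nonneg ht]; linarith
  refine (hfε h_dist).trans ?_
  rw [norm_pow, Real.norm_of_nonneg ht]
  gcongr

section Contraction

open Polynomial

variable {E F : Type*} [NormedAddCommGroup E] [InnerProductSpace ℂ E] [NormedAddCommGroup F]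
  [InnerProductSpace ℂ F] {L : E →L[ℂ] E} {B : E →L[ℂ] F}

theorem hasDerivAt_exp_smul_apply [CompleteSpace E] (L : E →L[ℂ] E) (u : E) (t : ℝ) :
    HasDerivAt (fun t : ℝ => NormedSpace.exp ((t : ℂ) • L) u)
      (L (NormedSpace.exp ((t : ℂ) • L) u)) t := by
  have h_complex := (ContinuousLinearMap.apply ℂ E u).hasFDerivAt.comp_hasDerivAt _
    (hasDerivAt_exp_smul_const' L (t : ℂ))
  exact (h_complex.scomp t Complex.ofRealCLM.hasDerivAt).congr_deriv (by simp)

theorem continuous_exp_smul_apply [CompleteSpace E] (L : E →L[ℂ] E) (u : E) :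
    Continuous fun t : ℝ => NormedSpace.exp ((t : ℂ) • L) u :=
  continuous_iff_continuousAt.2 fun t => (hasDerivAt_exp_smul_apply L u t).continuousAt

theorem IsDissipationFactor.hasDerivAt_norm_sq_exp [CompleteSpace E] (h : IsDissipationFactor L B)
    (u : E) (t : ℝ) :
    HasDerivAt (fun t : ℝ => ‖NormedSpace.exp ((t : ℂ) • L) u‖ ^ 2)
      (-2 * ‖B (NormedSpace.exp ((t : ℂ) • L) u)‖ ^ 2) t := by
  have hw := hasDerivAt_exp_smul_apply L u t
  have h_sq := Complex.reCLM.hasFDerivAt.comp_hasDerivAt t (hw.inner ℂ hw)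
  refine (h_sq.congr_of_eventuallyEq (.of_forall fun s => ?_)).congr_deriv ?_
  · exact norm_sq_eq_re_inner (𝕜 := ℂ) _
  · rw [Complex.reCLM_apply, Complex.add_re, ← inner_conj_symm (L _) _, Complex.conj_re,
      h.re_inner_apply_self]
    ring

theorem IsDissipationFactor.norm_sq_exp [CompleteSpace E] (h : IsDissipationFactor L B) (u : E)
    (τ : ℝ) : ‖NormedSpace.exp ((τ : ℂ) • L) u‖ ^ 2 =
      ‖u‖ ^ 2 - 2 * ∫ t in (0 : ℝ)..τ, ‖B (NormedSpace.exp ((t : ℂ) • L) u)‖ ^ 2 := by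
  have h_cont : Continuous fun t : ℝ => -2 * ‖B (NormedSpace.exp ((t : ℂ) • L) u)‖ ^ 2 :=
    ((B.continuous.comp (continuous_exp_smul_apply L u)).norm.pow 2).const_mul _
  have h_ftc := intervalIntegral.integral_eq_sub_of_hasDerivAt
    (fun t _ => h.hasDerivAt_norm_sq_exp u t) (h_cont.intervalIntegrable 0 τ)
  rw [intervalIntegral.integral_const_mul, Complex.ofReal_zero, zero_smul, NormedSpace.exp_zero,
    one_apply_eq_self] at h_ftc
  linarith

variable [FiniteDimensional ℂ E]

theorem exists_pos_mul_norm_le_of_unobservableSubspace_eq_bot {m : ℕ} {a : ℕ → ℂ}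
    (ha : ∀ j < m, a j ≠ 0) (hU : unobservableSubspace L B m = ⊥) :
    ∃ c : ℝ, 0 < c ∧ ∀ u, c * ‖u‖ ≤ ‖fun j : Fin m => a j • B ((L ^ j.val) u)‖ := by
  let O : E →ₗ[ℂ] Fin m → F := LinearMap.pi fun j => a j • (B ∘L L ^ j.val : E →ₗ[ℂ] F)
  have hO_ker : LinearMap.ker O = ⊥ := by
    refine (Submodule.eq_bot_iff _).2 fun u hu => ?_
    refine (Submodule.eq_bot_iff _).1 hU u (mem_unobservableSubspace.2 fun j hj => ?_)
    exact (smul_eq_zero.1 (congrFun (LinearMap.mem_ker.1 hu) ⟨j, hj⟩)).resolve_left (ha j hj)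
  obtain ⟨K, hK, hO⟩ := O.exists_antilipschitzWith hO_ker
  refine ⟨(K : ℝ)⁻¹, by positivity, fun u => ?_⟩
  rw [inv_mul_le_iff₀ (by positivity)]
  exact hO.le_mul_norm (map_zero O) u

theorem exists_pos_mul_pow_mul_norm_sq_le_integral_aeval [FiniteDimensional ℂ F] {m : ℕ} {q : ℂ[X]}
    (hq_deg : q.natDegree < m + 1) (hq : ∀ j < m + 1, q.coeff j ≠ 0)
    (hU : unobservableSubspace L B (m + 1) = ⊥) :
    ∃ c : ℝ, 0 < c ∧ ∀ (u : E) (τ : ℝ), 0 < τ → τ ≤ 1 →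
      c * τ ^ (2 * m + 1) * ‖u‖ ^ 2 ≤ ∫ t in (0 : ℝ)..τ, ‖B (aeval ((t : ℂ) • L) q u)‖ ^ 2 := by
  obtain ⟨c₁, hc₁, h_obs⟩ := exists_pos_mul_norm_le_of_unobservableSubspace_eq_bot hq hU
  obtain ⟨c₂, hc₂, h_int⟩ := exists_pos_mul_pow_mul_norm_sq_le_integral_sum_pow_smul (F := F) m
  refine ⟨c₂ * c₁ ^ 2, by positivity, fun u τ hτ hτ_one => ?_⟩
  have h_expand (t : ℝ) : B (aeval ((t : ℂ) • L) q u) =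
      ∑ j : Fin (m + 1), (t : ℂ) ^ j.val • q.coeff j • B ((L ^ j.val) u) := by
    rw [aeval_eq_sum_range' hq_deg, _root_.sum_apply, map_sum, Finset.sum_range]
    refine Finset.sum_congr rfl fun j _ => ?_
    rw [_root_.smul_pow, _root_.smul_apply, _root_.smul_apply, map_smul, map_smul, smul_comm]
  simp only [h_expand]
  refine le_trans ?_ (h_int (fun j => q.coeff j • B ((L ^ j.val) u)) τ hτ hτ_one)
  calc c₂ * c₁ ^ 2 * τ ^ (2 * m + 1) * ‖u‖ ^ 2
      = c₂ * τ ^ (2 * m + 1) * (c₁ * ‖u‖) ^ 2 := by ring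
    _ ≤ _ := by gcongr; exact h_obs u

theorem exists_pos_eventually_mul_pow_mul_norm_sq_le_integral_exp [FiniteDimensional ℂ F] {m : ℕ}
    (hU : unobservableSubspace L B (m + 1) = ⊥) :
    ∃ c : ℝ, 0 < c ∧ ∀ᶠ τ : ℝ in 𝓝[>] 0, ∀ u : E, c * τ ^ (2 * m + 1) * ‖u‖ ^ 2 ≤
      ∫ t in (0 : ℝ)..τ, ‖B (NormedSpace.exp ((t : ℂ) • L) u)‖ ^ 2 := by
  have : CompleteSpace E := FiniteDimensional.complete ℂ E
  let q : ℂ[X] := (PowerSeries.exp ℂ).trunc (m + 1)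
  have hq (j : ℕ) (hj : j < m + 1) : q.coeff j = (j.factorial : ℂ)⁻¹ := by
    simp [q, PowerSeries.coeff_trunc, hj]
  have hq_ne (j : ℕ) (hj : j < m + 1) : q.coeff j ≠ 0 := by
    simp [hq j hj, Nat.factorial_ne_zero]
  obtain ⟨c, hc, h_coercive⟩ := exists_pos_mul_pow_mul_norm_sq_le_integral_aeval (q := q)
    (PowerSeries.natDegree_trunc_lt _ m) hq_ne hU
  obtain ⟨C, h_close⟩ := exists_eventually_forall_mem_Icc_norm_le
    (exp_smul_sub_aeval_smul_isBigO L hq)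
  have h_small : ∀ᶠ τ : ℝ in 𝓝[>] 0, 4 * (‖B‖ * C * τ) ^ 2 < c :=
    Tendsto.eventually_lt_const hc (tendsto_nhdsWithin_of_tendsto_nhds
      (Continuous.tendsto' (by fun_prop) _ _ (by simp)))
  refine ⟨c / 4, by positivity, ?_⟩
  filter_upwards [Ioo_mem_nhdsGT one_pos, h_close, h_small] with τ ⟨hτ, hτ_one⟩ hτ_close hτ_small u
  have h_diff (t : ℝ) (ht : t ∈ Set.Icc 0 τ) :
      ‖B (aeval ((t : ℂ) • L) q u) - B (NormedSpace.exp ((t : ℂ) • L) u)‖ ≤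
        ‖B‖ * C * τ ^ (m + 1) * ‖u‖ := by
    rw [norm_sub_rev, ← map_sub, ← _root_.sub_apply, mul_assoc, mul_assoc, ← mul_assoc C]
    exact B.le_opNorm_of_le (ContinuousLinearMap.le_of_opNorm_le _ (hτ_close t ht) u)
  have h_int := integral_norm_sq_le_of_norm_sub_le hτ.le
    (B.continuous.comp (continuous_aeval_smul_apply L q u))
    (B.continuous.comp (continuous_exp_smul_apply L u)) h_diff
  have h_err : 4 * (τ * (‖B‖ * C * τ ^ (m + 1) * ‖u‖) ^ 2) ≤ c * τ ^ (2 * m + 1) * ‖u‖ ^ 2 := by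
    calc _ = 4 * (‖B‖ * C * τ) ^ 2 * τ ^ (2 * m + 1) * ‖u‖ ^ 2 := by ring
      _ ≤ _ := by gcongr
  simp only [Function.comp_apply, sub_zero] at h_int
  linarith [h_coercive u τ hτ hτ_one.le]

theorem IsDissipationFactor.exists_pos_eventually_norm_exp_le [FiniteDimensional ℂ F] {m : ℕ}
    (h : IsDissipationFactor L B) (hU : unobservableSubspace L B (m + 1) = ⊥) :
    ∃ c : ℝ, 0 < c ∧ ∀ᶠ τ : ℝ in 𝓝[>] 0,
      ‖NormedSpace.exp ((τ : ℂ) • L)‖ ≤ 1 - c * τ ^ (2 * m + 1) := by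
  have : CompleteSpace E := FiniteDimensional.complete ℂ E
  obtain ⟨c, hc, h_decay⟩ := exists_pos_eventually_mul_pow_mul_norm_sq_le_integral_exp hU
  have h_small : ∀ᶠ τ : ℝ in 𝓝[>] 0, c * τ ^ (2 * m + 1) < 1 :=
    Tendsto.eventually_lt_const one_pos (tendsto_nhdsWithin_of_tendsto_nhds
      (Continuous.tendsto' (by fun_prop) _ _ (by simp)))
  refine ⟨c, hc, ?_⟩
  filter_upwards [h_decay, h_small] with τ hτ_decay hτ_small
  refine ContinuousLinearMap.opNorm_le_bound _ (by linarith) fun u => ?_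
  refine (sq_le_sq₀ (norm_nonneg _) (mul_nonneg (by linarith) (norm_nonneg u))).1 ?_
  calc ‖NormedSpace.exp ((τ : ℂ) • L) u‖ ^ 2
      ≤ ‖u‖ ^ 2 - 2 * (c * τ ^ (2 * m + 1) * ‖u‖ ^ 2) := by
        rw [h.norm_sq_exp]
        linarith [hτ_decay u]
    _ ≤ ((1 - c * τ ^ (2 * m + 1)) * ‖u‖) ^ 2 := by
        linarith [sq_nonneg (c * τ ^ (2 * m + 1) * ‖u‖)]

theorem IsDissipationFactor.eventually_norm_aeval_le_one [FiniteDimensional ℂ F] {m : ℕ} {R : ℂ[X]}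
    (h : IsDissipationFactor L B) (hU : unobservableSubspace L B (m + 1) = ⊥)
    (hR : ∀ j < 2 * m + 2, R.coeff j = (j.factorial : ℂ)⁻¹) :
    ∀ᶠ τ : ℝ in 𝓝[>] 0, ‖aeval ((τ : ℂ) • L) R‖ ≤ 1 := by
  have : CompleteSpace E := FiniteDimensional.complete ℂ E
  obtain ⟨c, hc, h_decay⟩ := h.exists_pos_eventually_norm_exp_le hU
  obtain ⟨C, h_close⟩ := exists_eventually_forall_mem_Icc_norm_le
    (exp_smul_sub_aeval_smul_isBigO L hR)
  have h_small : ∀ᶠ τ : ℝ in 𝓝[>] 0, C * τ < c :=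
    Tendsto.eventually_lt_const hc (tendsto_nhdsWithin_of_tendsto_nhds
      (Continuous.tendsto' (by fun_prop) _ _ (by simp)))
  filter_upwards [self_mem_nhdsWithin, h_decay, h_close, h_small]
    with τ (hτ : 0 < τ) hτ_decay hτ_close hτ_small
  calc ‖aeval ((τ : ℂ) • L) R‖
      ≤ ‖NormedSpace.exp ((τ : ℂ) • L)‖ +
          ‖NormedSpace.exp ((τ : ℂ) • L) - aeval ((τ : ℂ) • L) R‖ := norm_le_norm_add_norm_sub _ _
    _ ≤ 1 - c * τ ^ (2 * m + 1) + C * τ ^ (2 * m + 2) :=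
        add_le_add hτ_decay (hτ_close τ (Set.right_mem_Icc.2 hτ.le))
    _ = 1 - (c - C * τ) * τ ^ (2 * m + 1) := by ring
    _ ≤ 1 := sub_le_self _ (mul_nonneg (sub_nonneg.2 hτ_small.le) (by positivity))

end Contraction

section HypocoercivityIndex

variable {n : ℕ} {L : Matrix (Fin n) (Fin n) ℂ}

theorem conjTranspose_skewPart (L : Matrix (Fin n) (Fin n) ℂ) : (skewPart L)ᴴ = -skewPart L := by
  rw [skewPart, conjTranspose_smul, conjTranspose_sub, conjTranspose_conjTranspose, ← smul_neg,
    neg_sub]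
  simp

theorem hermPart_add_skewPart (L : Matrix (Fin n) (Fin n) ℂ) : hermPart L + skewPart L = L := by
  rw [hermPart, skewPart]
  module

theorem isHermitian_hermPart (L : Matrix (Fin n) (Fin n) ℂ) : (hermPart L).IsHermitian := by
  rw [IsHermitian, hermPart, conjTranspose_smul, conjTranspose_add, conjTranspose_conjTranspose,
    add_comm]
  simp

theorem isHermitian_hcMatrix (L : Matrix (Fin n) (Fin n) ℂ) (m : ℕ) :
    (hcMatrix L m).IsHermitian := by
  refine isSelfAdjoint_sum _ fun j _ => ?_
  rw [← conjTranspose_pow]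
  exact isHermitian_mul_mul_conjTranspose _ (isHermitian_hermPart L)

theorem inner_toEuclideanCLM_apply {𝕜 ι : Type*} [RCLike 𝕜] [Fintype ι] [DecidableEq ι]
    (A : Matrix ι ι 𝕜) (x y : EuclideanSpace 𝕜 ι) :
    inner 𝕜 x (toEuclideanCLM (𝕜 := 𝕜) A y) = star x.ofLp ⬝ᵥ (A *ᵥ y.ofLp) := by
  rw [EuclideanSpace.inner_eq_star_dotProduct, dotProduct_comm, ofLp_toEuclideanCLM]

theorem inner_toEuclideanCLM_conjTranspose_apply {𝕜 ι : Type*} [RCLike 𝕜] [Fintype ι]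
    [DecidableEq ι] (A : Matrix ι ι 𝕜) (x y : EuclideanSpace 𝕜 ι) :
    inner 𝕜 x (toEuclideanCLM (𝕜 := 𝕜) Aᴴ y) = inner 𝕜 (toEuclideanCLM (𝕜 := 𝕜) A x) y := by
  rw [← star_eq_conjTranspose, map_star, ContinuousLinearMap.star_eq_adjoint,
    ContinuousLinearMap.adjoint_inner_right]

theorem inner_toEuclideanCLM_hermPart_apply (L : Matrix (Fin n) (Fin n) ℂ)
    (x y : EuclideanSpace ℂ (Fin n)) :
    inner ℂ x (toEuclideanCLM (𝕜 := ℂ) (hermPart L) y) =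
      (1 / 2) * (inner ℂ (toEuclideanCLM (𝕜 := ℂ) L x) y +
        inner ℂ x (toEuclideanCLM (𝕜 := ℂ) L y)) := by
  rw [hermPart, map_smul, map_add, _root_.smul_apply, _root_.add_apply, inner_smul_right,
    inner_add_right, inner_toEuclideanCLM_conjTranspose_apply, add_comm]

open scoped MatrixOrder in
theorem IsSemiDissipative.exists_isDissipationFactor (hL : IsSemiDissipative L) :
    ∃ B : EuclideanSpace ℂ (Fin n) →L[ℂ] EuclideanSpace ℂ (Fin n),
      IsDissipationFactor (toEuclideanCLM (𝕜 := ℂ) L) B := by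
  obtain ⟨B, hB⟩ := CStarAlgebra.nonneg_iff_eq_star_mul_self.1 hL.nonneg
  refine ⟨toEuclideanCLM (𝕜 := ℂ) B, fun x y => ?_⟩
  have h_herm := inner_toEuclideanCLM_hermPart_apply L x y
  rw [← neg_neg (hermPart L), hB, map_neg, map_mul, _root_.neg_apply, inner_neg_right,
    mul_apply_eq_comp, star_eq_conjTranspose, inner_toEuclideanCLM_conjTranspose_apply] at h_herm
  linear_combination (-2) * h_herm

section DissipationFactor

variable {F : Type*} [NormedAddCommGroup F] [InnerProductSpace ℂ F]
  {B : EuclideanSpace ℂ (Fin n) →L[ℂ] F}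

theorem IsDissipationFactor.inner_toEuclideanCLM_hermPart_apply
    (h : IsDissipationFactor (toEuclideanCLM (𝕜 := ℂ) L) B) (x y : EuclideanSpace ℂ (Fin n)) :
    inner ℂ x (toEuclideanCLM (𝕜 := ℂ) (hermPart L) y) = -inner ℂ (B x) (B y) := by
  rw [_root_.inner_toEuclideanCLM_hermPart_apply, h]
  ring

theorem IsDissipationFactor.isSemiDissipative
    (h : IsDissipationFactor (toEuclideanCLM (𝕜 := ℂ) L) B) : IsSemiDissipative L := by
  refine .of_dotProduct_mulVec_nonneg (isHermitian_hermPart L).neg fun x => ?_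
  rw [← inner_toEuclideanCLM_apply _ (WithLp.toLp 2 x) (WithLp.toLp 2 x), map_neg,
    _root_.neg_apply, inner_neg_right, h.inner_toEuclideanCLM_hermPart_apply, neg_neg,
    inner_self_eq_norm_sq_to_K]
  positivity

theorem IsDissipationFactor.unobservableSubspace_skewPart
    (h : IsDissipationFactor (toEuclideanCLM (𝕜 := ℂ) L) B) (k : ℕ) :
    unobservableSubspace (toEuclideanCLM (𝕜 := ℂ) (skewPart L)) B k =
      unobservableSubspace (toEuclideanCLM (𝕜 := ℂ) L) B k := by
  refine unobservableSubspace_congr (fun x hx => ?_) k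
  have h_herm : toEuclideanCLM (𝕜 := ℂ) (hermPart L) x = 0 := by
    refine ext_inner_left ℂ fun y => ?_
    rw [h.inner_toEuclideanCLM_hermPart_apply, hx, inner_zero_right, inner_zero_right, neg_zero]
  conv_rhs => rw [← hermPart_add_skewPart L]
  rw [map_add, _root_.add_apply, h_herm, zero_add]

theorem IsDissipationFactor.inner_toEuclideanCLM_hcMatrix_apply_self
    (h : IsDissipationFactor (toEuclideanCLM (𝕜 := ℂ) L) B) (m : ℕ)
    (x : EuclideanSpace ℂ (Fin n)) :
    inner ℂ x (toEuclideanCLM (𝕜 := ℂ) (-hcMatrix L m) x) =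
      ((∑ j ∈ Finset.range (m + 1), ‖B ((toEuclideanCLM (𝕜 := ℂ) (skewPart L) ^ j) x)‖ ^ 2 : ℝ) :
        ℂ) := by
  rw [hcMatrix, ← Finset.sum_neg_distrib, map_sum, _root_.sum_apply, inner_sum, Complex.ofReal_sum]
  refine Finset.sum_congr rfl fun j _ => ?_
  have h_sign : ‖B (toEuclideanCLM (𝕜 := ℂ) ((skewPart L)ᴴ ^ j) x)‖ =
      ‖B ((toEuclideanCLM (𝕜 := ℂ) (skewPart L) ^ j) x)‖ := by
    rw [conjTranspose_skewPart, neg_pow, map_mul, map_pow, map_pow, map_neg, map_one]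
    rcases neg_one_pow_eq_or (EuclideanSpace ℂ (Fin n) →L[ℂ] EuclideanSpace ℂ (Fin n)) j
      with h_pow | h_pow <;> simp [h_pow]
  rw [← h_sign, ← conjTranspose_pow, mul_assoc]
  nth_rw 1 [← conjTranspose_conjTranspose (skewPart L ^ j)]
  rw [map_neg, _root_.neg_apply, inner_neg_right, map_mul, mul_apply_eq_comp,
    inner_toEuclideanCLM_conjTranspose_apply, map_mul, mul_apply_eq_comp,
    h.inner_toEuclideanCLM_hermPart_apply, neg_neg, inner_self_eq_norm_sq_to_K]
  norm_cast

theorem IsDissipationFactor.posDef_neg_hcMatrix_iff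
    (h : IsDissipationFactor (toEuclideanCLM (𝕜 := ℂ) L) B) {m : ℕ} :
    (-hcMatrix L m).PosDef ↔ unobservableSubspace (toEuclideanCLM (𝕜 := ℂ) L) B (m + 1) = ⊥ := by
  have h_zero (x : EuclideanSpace ℂ (Fin n)) :
      ¬ 0 < inner ℂ x (toEuclideanCLM (𝕜 := ℂ) (-hcMatrix L m) x) ↔
        x ∈ unobservableSubspace (toEuclideanCLM (𝕜 := ℂ) L) B (m + 1) := by
    have h_nonneg (j : ℕ) (_ : j ∈ Finset.range (m + 1)) :
      0 ≤ ‖B ((toEuclideanCLM (𝕜 := ℂ) (skewPart L) ^ j) x)‖ ^ 2 := by positivity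
    rw [h.inner_toEuclideanCLM_hcMatrix_apply_self, Complex.zero_lt_real, not_lt,
      (Finset.sum_nonneg h_nonneg).ge_iff_eq', Finset.sum_eq_zero_iff_of_nonneg h_nonneg,
      ← h.unobservableSubspace_skewPart, mem_unobservableSubspace]
    simp only [Finset.mem_range, pow_eq_zero_iff two_ne_zero, norm_eq_zero]
  rw [posDef_iff_dotProduct_mulVec, and_iff_right (isHermitian_hcMatrix L m).neg,
    Submodule.eq_bot_iff]
  refine ((WithLp.equiv 2 (Fin n → ℂ)).forall_congr fun x => ?_).symm
  rw [← h_zero, not_imp_comm, WithLp.equiv_apply, ← inner_toEuclideanCLM_apply]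
  exact imp_congr_left (not_congr (WithLp.ofLp_eq_zero 2).symm)

theorem IsDissipationFactor.hcIndex_le_iff
    (h : IsDissipationFactor (toEuclideanCLM (𝕜 := ℂ) L) B) {m : ℕ} :
    hcIndex L ≤ m ↔ unobservableSubspace (toEuclideanCLM (𝕜 := ℂ) L) B (m + 1) = ⊥ := by
  refine ⟨fun h_le => ?_, fun hU => sInf_le ⟨m, rfl, h.posDef_neg_hcMatrix_iff.2 hU⟩⟩
  obtain ⟨k, hk, h_posDef⟩ : hcIndex L ∈ {k : ℕ∞ | ∃ m : ℕ, k = m ∧ (-hcMatrix L m).PosDef} := by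
    refine csInf_mem (Set.nonempty_iff_ne_empty.2 fun h_empty => ?_)
    rw [hcIndex, h_empty, sInf_empty] at h_le
    exact ENat.natCast_ne_top m (top_le_iff.1 h_le)
  rw [hk, Nat.cast_le] at h_le
  exact eq_bot_mono (unobservableSubspace_antitone _ B (Nat.succ_le_succ h_le))
    (h.posDef_neg_hcMatrix_iff.1 h_posDef)

end DissipationFactor

theorem hasEigenvalue_toEuclideanCLM_iff {μ : ℂ} :
    Module.End.HasEigenvalue
        (toEuclideanCLM (𝕜 := ℂ) L : EuclideanSpace ℂ (Fin n) →ₗ[ℂ] EuclideanSpace ℂ (Fin n)) μ ↔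
      Module.End.HasEigenvalue (toLin' L) μ := by
  rw [coe_toEuclideanCLM_eq_toEuclideanLin, Module.End.hasEigenvalue_iff_mem_spectrum,
    spectrum_toLpLin, Module.End.hasEigenvalue_iff_mem_spectrum, spectrum_toLin']

end HypocoercivityIndex

section DampedOscillators

variable {n : ℕ}

/-- The sum of the coordinates, the only quantity that `dampedOscillators` dissipates. -/
noncomputable def coordSum (n : ℕ) : EuclideanSpace ℂ (Fin n) →L[ℂ] ℂ :=
  ∑ a, EuclideanSpace.proj a

theorem coordSum_apply (x : EuclideanSpace ℂ (Fin n)) : coordSum n x = ∑ a, x a := by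
  simp [coordSum]

/-- Undamped oscillators with frequencies `ω`, coupled by a rank-one damping. A single observation
cannot determine `n` coordinates quickly, so the hypocoercivity index grows with `n`. -/
def dampedOscillators (ω : Fin n → ℝ) : Matrix (Fin n) (Fin n) ℂ :=
  diagonal (fun a => Complex.I * ω a) - of fun _ _ => 1

theorem toEuclideanCLM_dampedOscillators_apply (ω : Fin n → ℝ) (x : EuclideanSpace ℂ (Fin n))
    (a : Fin n) :
    toEuclideanCLM (𝕜 := ℂ) (dampedOscillators ω) x a =
      Complex.I * ω a * x a - coordSum n x := by
  rw [ofLp_toEuclideanCLM, dampedOscillators, sub_mulVec, Pi.sub_apply, mulVec_diagonal,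
    coordSum_apply]
  simp [mulVec, dotProduct]

theorem isDissipationFactor_dampedOscillators (ω : Fin n → ℝ) :
    IsDissipationFactor (toEuclideanCLM (𝕜 := ℂ) (dampedOscillators ω)) (coordSum n) := by
  intro x y
  simp only [PiLp.inner_apply, toEuclideanCLM_dampedOscillators_apply, RCLike.inner_apply,
    map_sub, map_mul, Complex.conj_I, Complex.conj_ofReal, ← Finset.sum_add_distrib]
  calc _ = ∑ a, (-(y a * starRingEnd ℂ (coordSum n x)) -
        coordSum n y * starRingEnd ℂ (x a)) := Finset.sum_congr rfl fun a _ => by ring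
    _ = _ := by
      rw [Finset.sum_sub_distrib, Finset.sum_neg_distrib, ← Finset.sum_mul, ← Finset.mul_sum,
        ← map_sum, ← coordSum_apply, ← coordSum_apply]
      ring

theorem isAsymptoticallyStable_dampedOscillators {ω : Fin n → ℝ} (hω : Function.Injective ω) :
    IsAsymptoticallyStable (dampedOscillators ω) := by
  intro μ hμ
  refine (isDissipationFactor_dampedOscillators ω).re_neg_of_hasEigenvalue ?_
    (hasEigenvalue_toEuclideanCLM_iff.2 hμ)
  intro x hx hx_sum
  have h_eig (a : Fin n) : (Complex.I * ω a - μ) * x a = 0 := by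
    have h_coord := congrArg (fun v : EuclideanSpace ℂ (Fin n) => v a) hx
    simp only [toEuclideanCLM_dampedOscillators_apply, hx_sum, PiLp.smul_apply, smul_eq_mul]
      at h_coord
    linear_combination h_coord
  by_contra hx_ne
  obtain ⟨a, ha⟩ : ∃ a, x a ≠ 0 := by
    by_contra! h_zero
    exact hx_ne (PiLp.ext h_zero)
  have h_ne (b : Fin n) (hb : b ≠ a) : x b = 0 := by
    refine (mul_eq_zero.1 (h_eig b)).resolve_left fun hb' => hb (hω ?_)
    have ha' := (mul_eq_zero.1 (h_eig a)).resolve_right ha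
    exact Complex.ofReal_injective
      (mul_left_cancel₀ Complex.I_ne_zero (by linear_combination hb' - ha'))
  rw [coordSum_apply, Fintype.sum_eq_single a h_ne] at hx_sum
  exact ha hx_sum

theorem dampedOscillators_mem_LAS {ω : Fin n → ℝ} (hω : Function.Injective ω) :
    (⟨n, dampedOscillators ω⟩ : Σ n : ℕ, Matrix (Fin n) (Fin n) ℂ) ∈ LAS :=
  ⟨isAsymptoticallyStable_dampedOscillators hω,
    (isDissipationFactor_dampedOscillators ω).isSemiDissipative⟩

theorem lt_hcIndex_dampedOscillators (ω : Fin n → ℝ) {m : ℕ} (hm : m + 1 < n) :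
    (m : ℕ∞) < hcIndex (dampedOscillators ω) := by
  rw [← not_le, (isDissipationFactor_dampedOscillators ω).hcIndex_le_iff]
  exact unobservableSubspace_ne_bot _ _ (by simpa)

theorem exists_mem_LAS_lt_hcIndex (m : ℕ) : ∃ L ∈ LAS, (m : ℕ∞) < hcIndex L.2 :=
  ⟨_, dampedOscillators_mem_LAS (ω := fun a : Fin (m + 2) => (a : ℝ))
    (Nat.cast_injective.comp Fin.val_injective),
    lt_hcIndex_dampedOscillators _ (Nat.lt_add_one (m + 1))⟩

end DampedOscillators

theorem ExplicitRK.HasOrder.stronglyStableOn_LASle {M : ExplicitRK} {p : ℕ} (hM : M.HasOrder p)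
    {m : ℕ} (hm : 2 * m + 1 ≤ p) : M.StronglyStableOn (LASle m) := by
  rw [ExplicitRK.stronglyStableOn_iff]
  rintro L ⟨⟨-, hL⟩, h_index⟩
  obtain ⟨B, hB⟩ := hL.exists_isDissipationFactor
  exact hB.eventually_norm_aeval_le_one (hB.hcIndex_le_iff.1 h_index) fun j hj =>
    hM.coeff_stabilityFunction (by omega)

theorem ExplicitRK.HasOrder.not_stronglyStableOn_singleton {M : ExplicitRK} {p : ℕ}
    (hM : M.HasOrder p) (hp : 1 ≤ p) {c : ℝ} (hc : M.stabilityCoeff (p + 1) = c)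
    (hs : SignCondition p c) {L : Σ n : ℕ, Matrix (Fin n) (Fin n) ℂ} (hL : L ∈ LAS)
    (h_index : (p : ℕ∞) < 2 * hcIndex L.2 + 1) : ¬ M.StronglyStableOn {L} := by
  rw [ExplicitRK.stronglyStableOn_iff]
  intro h_stable
  obtain ⟨B, hB⟩ := hL.2.exists_isDissipationFactor
  have hU : unobservableSubspace (toEuclideanCLM (𝕜 := ℂ) L.2) B ((p + 1) / 2) ≠ ⊥ := by
    rw [← Nat.sub_add_cancel (show 1 ≤ (p + 1) / 2 by omega), Ne, ← hB.hcIndex_le_iff]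
    intro h_le
    refine h_index.not_ge (le_trans (by gcongr : _ ≤ 2 * (((p + 1) / 2 - 1 : ℕ) : ℕ∞) + 1) ?_)
    exact_mod_cast (by omega : 2 * ((p + 1) / 2 - 1) + 1 ≤ p)
  have h_unstable := hB.eventually_one_lt_norm_aeval_of_signCondition
    (fun μ hμ => hL.1 μ (hasEigenvalue_toEuclideanCLM_iff.1 hμ))
    (fun j hj => hM.coeff_stabilityFunction hj) hc hs hU
  obtain ⟨τ, hτ_le, hτ_lt⟩ := ((h_stable L rfl).and h_unstable).exists
  exact hτ_lt.not_ge hτ_le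

theorem mainTheorem2 (M : ExplicitRK) (p : ℕ) (hp : 1 ≤ p) (hM : M.HasOrder p) :
    (∀ m : ℕ, 2 * m + 1 ≤ p → M.StronglyStableOn (LASle m)) ∧
    (∀ c : ℝ, M.stabilityCoeff (p + 1) = (c : ℂ) → SignCondition p c →
      ¬ M.StronglyStableOn LAS ∧
      (∀ L ∈ LAS, (p : ℕ∞) < 2 * hcIndex L.2 + 1 → ¬ M.StronglyStableOn {L}) ∧
      (∀ m : ℕ, 2 * m + 1 ≤ p →
        M.StronglyStableOn (LASle m) ∧ ¬ M.StronglyStableOn (LAS \ LASle m))) := by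
  refine ⟨fun m hm => hM.stronglyStableOn_LASle hm, fun c hc hs => ?_⟩
  have h_unstable (L) (hL : L ∈ LAS) (h_index : (p : ℕ∞) < 2 * hcIndex L.2 + 1) :
      ¬ M.StronglyStableOn {L} :=
    hM.not_stronglyStableOn_singleton hp hc hs hL h_index
  obtain ⟨L, hL, h_index⟩ := exists_mem_LAS_lt_hcIndex p
  have hL_unstable : ¬ M.StronglyStableOn {L} := h_unstable L hL <| calc
    (p : ℕ∞) < hcIndex L.2 := h_index
    _ ≤ 2 * hcIndex L.2 + 1 := (le_mul_of_one_le_left' one_le_two).trans le_self_add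
  refine ⟨fun h => hL_unstable (h.mono (Set.singleton_subset_iff.2 hL)), h_unstable,
    fun m hm => ⟨hM.stronglyStableOn_LASle hm, fun h => hL_unstable (h.mono ?_)⟩⟩
  refine Set.singleton_subset_iff.2 ⟨hL, fun hL_le => ?_⟩
  exact absurd (h_index.trans_le hL_le.2) (by norm_cast; omega)
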